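/- Let $\mathcal H$ be a nonzero separable complex Hilbert space, let $\mathcal B^1(\mathcal H)$ denote the space of trace-class operators on $\mathcal H$ with the trace norm $\nu_1$, and let $T:\mathcal B^1(\mathcal H)\to\mathcal B^1(\mathcal H)$ be a Schrödinger quantum channel, i.e. a linear, completely positive and trace-preserving map. Then there exist a separable complex Hilbert space $\mathcal K$, a pure state $\omega$ on $\mathcal K$ (a positive semidefinite trace-class operator of trace one and rank one) and a unitary operator $V$ on $\mathcal H\otimes\mathcal K$ such that $$T^n(A)=\operatorname{tr}_{\mathcal K}\bigl(V^n(A\otimes\omega)(V^\dagger)^n\bigr)\qquad\text{for all } A\in\mathcal B^1(\mathcal H),\ n\in\mathbb N_0 ,$$ where the partial trace $\operatorname{tr}_{\mathcal K}:\mathcal B^1(\mathcal H\otimes\mathcal K)\to\mathcal B^1(\mathcal H)$ is the linear map determined by $\operatorname{tr}(B\operatorname{tr}_{\mathcal K}(A))=\operatorname{tr}((B\otimes\operatorname{id}_{\mathcal K})A)$ for all $B\in\mathcal B(\mathcal H)$ and $A\in\mathcal B^1(\mathcal H\otimes\mathcal K)$. Moreover, with $J=i_\omega:A\mapsto A\otimes\omega$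 and $E=\operatorname{tr}_{\mathcal K}$, the tuple $(\mathcal H\otimes\mathcal K,(V^n)_{n\in\mathbb Z},J,E)$ is a unitary dilation of the semigroup $(T^n)_{n\in\mathbb N_0}$. That is: $n\mapsto V^n$ is a representation of the group $\mathbb Z$ by unitary operators; $J$ is linear and completely positive, and its operator norm with respect to the trace norms is $\|J\|=1$; $E$ is linear and completely positive and satisfies $E(E^*(B)A)=B\,E(A)$ for all $B\in\mathcal B(\mathcal H)$ and $A\in\mathcal B^1(\mathcal H\otimes\mathcal K)$, where $E^*:\mathcal B(\mathcal H)\to\mathcal B(\mathcal H\otimes\mathcal K)$ is the dual map given by $\operatorname{tr}(B\,E(A))=\operatorname{tr}(E^*(B)A)$; $E\circ J=\operatorname{id}_{\mathcal B^1(\mathcal H)}$; and $T^n=E\circ\operatorname{Ad}_{V^n}\circ J$ for all $n\in\mathbb N_0$, where $\operatorname{Ad}_U(A)=UAU^\dagger$. -/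

import Mathlib

open scoped InnerProductSpace TensorProduct ComplexOrder ENNReal

set_option linter.unusedSectionVars false

noncomputable section

namespace QuantumDilation

section Operators

variable {H G F : Type*}
  [NormedAddCommGroup H] [InnerProductSpace ℂ H] [CompleteSpace H]
  [NormedAddCommGroup G] [InnerProductSpace ℂ G] [CompleteSpace G]
  [NormedAddCommGroup F] [InnerProductSpace ℂ F] [CompleteSpace F]

/-- `A` is trace class: `∑ ⟨e_i, √(A†A) e_i⟩` is summable for some orthonormal basis `(e_i)`. -/
def IsTraceClass (A : H →L[ℂ] H) : Prop :=
  ∃ (w : Set H) (b : HilbertBasis w ℂ H), Summable fun i => ⟪b i, CFC.abs A (b i)⟫_ℂ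

/-- The index set of a fixed orthonormal basis of `H`. -/
def stdIndex (H : Type*) [NormedAddCommGroup H] [InnerProductSpace ℂ H] [CompleteSpace H] :
    Set H := (exists_hilbertBasis ℂ H).choose

/-- A fixed orthonormal basis of `H`. -/
def stdBasis (H : Type*) [NormedAddCommGroup H] [InnerProductSpace ℂ H] [CompleteSpace H] :
    HilbertBasis (stdIndex H) ℂ H := (exists_hilbertBasis ℂ H).choose_spec.choose

/-- The trace `∑ ⟨e_i, A e_i⟩`, computed in a fixed orthonormal basis.  It is only applied to
trace-class operators, where the sum converges and does not depend on the basis. -/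
def trace (A : H →L[ℂ] H) : ℂ := ∑' i, ⟪stdBasis H i, A (stdBasis H i)⟫_ℂ

/-! Hilbert-Schmidt sums, used only to show that trace-class operators form an ideal. -/

/-- `∑ ‖X e_i‖²` over an orthonormal basis. -/
def hsSum {ι : Type*} (b : HilbertBasis ι ℂ H) (X : H →L[ℂ] G) : ℝ≥0∞ := ∑' i, ‖X (b i)‖ₑ ^ 2

theorem parseval {ι : Type*} (b : HilbertBasis ι ℂ H) (x : H) :
    ‖x‖ₑ ^ 2 = ∑' i, ‖⟪b i, x⟫_ℂ‖ₑ ^ 2 := by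
  have h := b.hasSum_inner_mul_inner x x
  have h2 : HasSum (fun i => ‖⟪b i, x⟫_ℂ‖ ^ 2) (‖x‖ ^ 2) := by
    have := Complex.hasSum_re h
    convert this using 1
    · ext i
      rw [← inner_conj_symm x (b i), ← Complex.normSq_eq_conj_mul_self, Complex.ofReal_re,
        Complex.normSq_eq_norm_sq]
    · rw [inner_self_eq_norm_sq_to_K]
      norm_cast
  have h3 : ∀ z : ℝ, 0 ≤ z → ENNReal.ofReal (z ^ 2) = ENNReal.ofReal z ^ 2 :=
    fun z hz => ENNReal.ofReal_pow hz 2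
  simp only [← ofReal_norm]
  rw [← h3 _ (norm_nonneg _), ← h2.tsum_eq,
    ENNReal.ofReal_tsum_of_nonneg (fun i => by positivity) h2.summable]
  exact tsum_congr fun i => h3 _ (norm_nonneg _)

theorem hsSum_adjoint {ι κ : Type*} (b : HilbertBasis ι ℂ H) (c : HilbertBasis κ ℂ G)
    (X : H →L[ℂ] G) : hsSum b X = hsSum c (ContinuousLinearMap.adjoint X) := by
  unfold hsSum
  simp_rw [parseval c (X _), parseval b (ContinuousLinearMap.adjoint X _)]
  rw [ENNReal.tsum_comm]
  refine tsum_congr fun j => tsum_congr fun i => ?_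
  rw [ContinuousLinearMap.adjoint_inner_right, ← ofReal_norm, ← ofReal_norm, norm_inner_symm]

theorem hsSum_basis {ι κ : Type*} (b : HilbertBasis ι ℂ H) (b' : HilbertBasis κ ℂ H)
    (X : H →L[ℂ] G) : hsSum b X = hsSum b' X := by
  rw [hsSum_adjoint b (stdBasis G), hsSum_adjoint b' (stdBasis G)]

theorem hsSum_comp_left {ι : Type*} (b : HilbertBasis ι ℂ H) (X : H →L[ℂ] G) (W : G →L[ℂ] F)
    (hX : hsSum b X ≠ ⊤) : hsSum b (W ∘L X) ≠ ⊤ := by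
  have : hsSum b (W ∘L X) ≤ ‖W‖ₑ ^ 2 * hsSum b X := by
    unfold hsSum
    rw [← ENNReal.tsum_mul_left]
    refine ENNReal.tsum_le_tsum fun i => ?_
    rw [← mul_pow]
    gcongr
    exact W.le_opENorm _
  exact ne_top_of_le_ne_top (ENNReal.mul_ne_top (by simp) hX) this

theorem hsSum_comp_right {ι κ : Type*} (b : HilbertBasis ι ℂ H) (c : HilbertBasis κ ℂ G)
    (X : G →L[ℂ] F) (W : H →L[ℂ] G) (hX : hsSum c X ≠ ⊤) : hsSum b (X ∘L W) ≠ ⊤ := by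
  rw [hsSum_adjoint b (stdBasis F), ContinuousLinearMap.adjoint_comp]
  apply hsSum_comp_left
  rwa [← hsSum_adjoint c]

theorem summable_of_hsSum {ι : Type*} (b : HilbertBasis ι ℂ H) (X : H →L[ℂ] G)
    (hX : hsSum b X ≠ ⊤) : Summable fun i => ‖X (b i)‖ ^ 2 := by
  have := ENNReal.summable_toReal hX
  simpa using this

theorem summable_inner_of_hsSum {ι : Type*} (b : HilbertBasis ι ℂ H) (X Y : H →L[ℂ] G)
    (hX : hsSum b X ≠ ⊤) (hY : hsSum b Y ≠ ⊤) : Summable fun i => ⟪X (b i), Y (b i)⟫_ℂ := by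
  refine Summable.of_norm_bounded ((summable_of_hsSum b X hX).add (summable_of_hsSum b Y hY)) ?_
  intro i
  have := norm_inner_le_norm (𝕜 := ℂ) (X (b i)) (Y (b i))
  nlinarith [sq_nonneg (‖X (b i)‖ - ‖Y (b i)‖), sq_nonneg (‖X (b i)‖), sq_nonneg (‖Y (b i)‖)]

theorem exists_comp_eq (P Q : H →L[ℂ] H) (h : ∀ x, ‖P x‖ ≤ ‖Q x‖) :
    ∃ W : H →L[ℂ] H, P = W ∘L Q := by
  let p : Submodule ℂ H := (LinearMap.range Q.toLinearMap).topologicalClosure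
  have hmem : ∀ x, Q x ∈ p := fun x => Submodule.le_topologicalClosure _ ⟨x, rfl⟩
  let e : H →ₗ[ℂ] p := Q.toLinearMap.codRestrict p hmem
  have hd : DenseRange e := by
    intro y
    rw [Metric.mem_closure_iff]
    intro ε hε
    obtain ⟨z, ⟨x, rfl⟩, hz⟩ := Metric.mem_closure_iff.1 y.2 ε hε
    exact ⟨e x, ⟨x, rfl⟩, hz⟩
  have hp : IsClosed (p : Set H) := Submodule.isClosed_topologicalClosure _
  have : CompleteSpace p := hp.completeSpace_coe
  refine ⟨(P.toLinearMap.extendOfNorm e) ∘L p.orthogonalProjectionOnto, ?_⟩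
  ext x
  have h1 : p.orthogonalProjectionOnto (Q x) = e x :=
    Submodule.orthogonalProjectionOnto_mem_subspace_eq_self (K := p) ⟨Q x, hmem x⟩
  simp only [ContinuousLinearMap.comp_apply, h1]
  rw [LinearMap.extendOfNorm_eq hd ⟨1, fun y => by simpa [e] using h y⟩]
  rfl

theorem norm_abs_apply (A : H →L[ℂ] H) (x : H) : ‖CFC.abs A x‖ = ‖A x‖ := by
  have h0 : star (CFC.abs A) = CFC.abs A := (CFC.abs_nonneg A).isSelfAdjoint.star_eq
  have h1 : star (CFC.abs A) * CFC.abs A = star A * A := by rw [h0, CFC.abs_mul_abs]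
  have h2 : ∀ B : H →L[ℂ] H, ‖B x‖ ^ 2 = RCLike.re ⟪(star B * B) x, x⟫_ℂ := fun B => by
    rw [ContinuousLinearMap.star_eq_adjoint, mul_apply_eq_comp,
      ContinuousLinearMap.adjoint_inner_left, inner_self_eq_norm_sq]
  have h3 : ‖CFC.abs A x‖ ^ 2 = ‖A x‖ ^ 2 := by rw [h2, h2, h1]
  exact (sq_eq_sq₀ (norm_nonneg _) (norm_nonneg _)).1 h3

theorem isTraceClass_of_summable {A : H →L[ℂ] H} {w : Set H} (b : HilbertBasis w ℂ H)
    (h : ∀ W : H →L[ℂ] H, Summable fun i => ⟪b i, W (A (b i))⟫_ℂ) : IsTraceClass A := by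
  obtain ⟨W, hW⟩ := exists_comp_eq (CFC.abs A) A fun x => (norm_abs_apply A x).le
  exact ⟨w, b, by rw [hW]; exact h W⟩

theorem isTraceClass_of_factor {ι : Type*} (b : HilbertBasis ι ℂ H) (X Y : H →L[ℂ] G)
    (hX : hsSum b X ≠ ⊤) (hY : hsSum b Y ≠ ⊤) :
    IsTraceClass (ContinuousLinearMap.adjoint X ∘L Y) := by
  refine isTraceClass_of_summable (stdBasis H) fun W => ?_
  have h1 : hsSum (stdBasis H) (X ∘L ContinuousLinearMap.adjoint W) ≠ ⊤ :=
    hsSum_comp_right _ b _ _ hX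
  have h2 : hsSum (stdBasis H) Y ≠ ⊤ := by rwa [hsSum_basis _ b]
  convert summable_inner_of_hsSum _ _ _ h1 h2 using 2 with i
  rw [ContinuousLinearMap.comp_apply, ContinuousLinearMap.comp_apply,
    ← ContinuousLinearMap.adjoint_inner_right, ← ContinuousLinearMap.adjoint_inner_left]

theorem IsTraceClass.exists_factor {A : H →L[ℂ] H} (hA : IsTraceClass A) :
    ∃ X Y : H →L[ℂ] H, A = ContinuousLinearMap.adjoint X ∘L Y ∧
      ∀ {ι : Type _} (b : HilbertBasis ι ℂ H), hsSum b X ≠ ⊤ ∧ hsSum b Y ≠ ⊤ := by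
  obtain ⟨w, b, hb⟩ := hA
  obtain ⟨W, hW⟩ := exists_comp_eq A (CFC.abs A) fun x => (norm_abs_apply A x).ge
  set R := CFC.sqrt (CFC.abs A) with hR
  have hRR : R * R = CFC.abs A := CFC.sqrt_mul_sqrt_self _ (CFC.abs_nonneg A)
  have hRs : ContinuousLinearMap.adjoint R = R :=
    (CFC.sqrt_nonneg (CFC.abs A)).isSelfAdjoint.star_eq
  have hsR : hsSum b R ≠ ⊤ := by
    have h1 : Summable fun i => ‖R (b i)‖ ^ 2 := by
      convert Complex.hasSum_re hb.hasSum |>.summable using 2 with i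
      rw [← hRR, mul_apply_eq_comp, ← ContinuousLinearMap.adjoint_inner_left, hRs,
        inner_self_eq_norm_sq_to_K]
      norm_cast
    have h2 := h1.tsum_ofReal_ne_top
    unfold hsSum
    convert h2 using 3 with i
    rw [ENNReal.ofReal_pow (norm_nonneg _), ofReal_norm]
  refine ⟨ContinuousLinearMap.adjoint (W ∘L R), R, ?_, fun {ι} c => ⟨?_, ?_⟩⟩
  · rw [ContinuousLinearMap.adjoint_adjoint, hW, ← hRR]
    rfl
  · rw [← hsSum_adjoint b]
    exact hsSum_comp_left _ _ _ hsR
  · rwa [hsSum_basis c b]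

theorem IsTraceClass.comp {A : H →L[ℂ] H} (hA : IsTraceClass A) (B C : H →L[ℂ] H) :
    IsTraceClass (B ∘L A ∘L C) := by
  obtain ⟨X, Y, rfl, h⟩ := hA.exists_factor
  have := isTraceClass_of_factor (stdBasis H) (X ∘L ContinuousLinearMap.adjoint B) (Y ∘L C)
    (hsSum_comp_right _ _ _ _ (h (stdBasis H)).1) (hsSum_comp_right _ _ _ _ (h (stdBasis H)).2)
  rwa [ContinuousLinearMap.adjoint_comp, ContinuousLinearMap.adjoint_adjoint] at this

theorem IsTraceClass.summable {A : H →L[ℂ] H} (hA : IsTraceClass A) {ι : Type*}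
    (b : HilbertBasis ι ℂ H) : Summable fun i => ⟪b i, A (b i)⟫_ℂ := by
  obtain ⟨X, Y, rfl, h⟩ := hA.exists_factor
  convert summable_inner_of_hsSum b X Y ?_ ?_ using 2 with i
  · simp [ContinuousLinearMap.adjoint_inner_right]
  · rw [hsSum_basis b (stdBasis H)]; exact (h _).1
  · rw [hsSum_basis b (stdBasis H)]; exact (h _).2

theorem IsTraceClass.summable_left {A : H →L[ℂ] H} (hA : IsTraceClass A) {ι : Type*}
    (b : HilbertBasis ι ℂ H) (W : H →L[ℂ] H) : Summable fun i => ⟪b i, W (A (b i))⟫_ℂ :=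
  (hA.comp W (ContinuousLinearMap.id ℂ H)).summable b

/-- The space `B¹(H)` of trace-class operators. -/
def traceClass (H : Type*) [NormedAddCommGroup H] [InnerProductSpace ℂ H] [CompleteSpace H] :
    Submodule ℂ (H →L[ℂ] H) where
  carrier := {A | IsTraceClass A}
  zero_mem' := isTraceClass_of_summable (stdBasis H) fun W => by simp
  add_mem' {A B} hA hB := isTraceClass_of_summable (stdBasis H) fun W => by
    simpa [inner_add_right] using
      (IsTraceClass.summable_left hA (stdBasis H) W).add (IsTraceClass.summable_left hB _ W)
  smul_mem' c A hA := isTraceClass_of_summable (stdBasis H) fun W => by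
    simpa [inner_smul_right] using
      (IsTraceClass.summable_left hA (stdBasis H) W).mul_left c

theorem trace_rankOne_comp (X : H →L[ℂ] H) (x y : H) :
    trace (InnerProductSpace.rankOne ℂ y x ∘L X) = ⟪x, X y⟫_ℂ := by
  have h := (stdBasis H).tsum_inner_mul_inner (ContinuousLinearMap.adjoint X x) y
  rw [ContinuousLinearMap.adjoint_inner_left] at h
  rw [← h, trace]
  refine tsum_congr fun i => ?_
  rw [ContinuousLinearMap.comp_apply, InnerProductSpace.rankOne_apply, inner_smul_right,
    ContinuousLinearMap.adjoint_inner_left]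

/-- The trace norm `ν₁(A) = tr √(A†A)`. -/
def traceNorm (A : traceClass H) : ℝ := (trace (CFC.abs (A : H →L[ℂ] H))).re

/-- Left multiplication `A ↦ B A` on `B¹(H)`. -/
def leftMul (B : H →L[ℂ] H) : traceClass H →ₗ[ℂ] traceClass H where
  toFun A := ⟨B ∘L (A : H →L[ℂ] H), IsTraceClass.comp A.2 B (ContinuousLinearMap.id ℂ H)⟩
  map_add' A A' := Subtype.ext (by simp)
  map_smul' c A := Subtype.ext (by simp)

/-- Conjugation `Ad_U : A ↦ U A U†` on `B¹(H)`. -/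
def Ad (U : H →L[ℂ] H) : traceClass H →ₗ[ℂ] traceClass H where
  toFun A := ⟨U ∘L (A : H →L[ℂ] H) ∘L ContinuousLinearMap.adjoint U, IsTraceClass.comp A.2 _ _⟩
  map_add' A A' := Subtype.ext (by simp)
  map_smul' c A := Subtype.ext (by simp)

/-- A state: a positive semidefinite trace-class operator of trace one. -/
def IsState (ρ : traceClass H) : Prop :=
  (ρ : H →L[ℂ] H).IsPositive ∧ trace (ρ : H →L[ℂ] H) = 1

/-- A pure state: a state of rank one. -/
def IsPureState (ρ : traceClass H) : Prop :=
  IsState ρ ∧ (ρ : H →L[ℂ] H).toLinearMap.rank = 1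

/-- Complete positivity of `T : B¹(H) → B¹(G)`.  An operator on `H ⊗ ℂⁿ` is an `n × n` matrix
`(A i j)` of operators on `H`, it is trace class iff all its entries are, its quadratic form at
`∑ x_i ⊗ e_i` is `∑ ⟨x_i, A_ij x_j⟩`, and `T ⊗ id_n` acts on it entrywise. -/
def IsCompletelyPositive (T : traceClass H →ₗ[ℂ] traceClass G) : Prop :=
  ∀ (n : ℕ) (A : Fin n → Fin n → traceClass H),
    (∀ x : Fin n → H, 0 ≤ ∑ i, ∑ j, ⟪x i, (A i j : H →L[ℂ] H) (x j)⟫_ℂ) →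
    ∀ y : Fin n → G, 0 ≤ ∑ i, ∑ j, ⟪y i, (T (A i j) : G →L[ℂ] G) (y j)⟫_ℂ

/-- A Schrödinger quantum channel: linear, completely positive and trace-preserving. -/
def IsSchrodingerChannel (T : traceClass H →ₗ[ℂ] traceClass G) : Prop :=
  IsCompletelyPositive T ∧
    ∀ A : traceClass H, trace (T A : G →L[ℂ] G) = trace (A : H →L[ℂ] H)

/-- `S : B(G) → B(H)` is the dual of `T : B¹(H) → B¹(G)`:  `tr(B T(A)) = tr(S(B) A)`. -/
def IsDualMap (T : traceClass H →ₗ[ℂ] traceClass G)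
    (S : (G →L[ℂ] G) →ₗ[ℂ] (H →L[ℂ] H)) : Prop :=
  ∀ (B : G →L[ℂ] G) (A : traceClass H),
    trace (B ∘L (T A : G →L[ℂ] G)) = trace (S B ∘L (A : H →L[ℂ] H))

/-- `(G, (U_n)_{n ∈ ℤ}, J, E)` is a unitary dilation of the discrete semigroup `(Tⁿ)_{n ∈ ℕ}`
on `B¹(H)`. -/
structure IsUnitaryDilation (T : traceClass H →ₗ[ℂ] traceClass H)
    (U : ℤ → unitary (G →L[ℂ] G))
    (J : traceClass H →ₗ[ℂ] traceClass G) (E : traceClass G →ₗ[ℂ] traceClass H) : Prop where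
  /-- `U` is a representation of the group `ℤ` by unitary operators. -/
  map_zero : U 0 = 1
  map_add : ∀ m n, U (m + n) = U m * U n
  /-- `J` is completely positive. -/
  cp_J : IsCompletelyPositive J
  /-- The operator norm of `J` with respect to the trace norms is one. -/
  norm_J : IsLeast {c : ℝ | 0 ≤ c ∧ ∀ A, traceNorm (J A) ≤ c * traceNorm A} 1
  /-- `E` is completely positive. -/
  cp_E : IsCompletelyPositive E
  /-- `E (E* (B) A) = B E(A)`, where `E*` is the dual map of `E`. -/
  dual_E : ∃ E' : (H →L[ℂ] H) →ₗ[ℂ] (G →L[ℂ] G), IsDualMap E E' ∧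
    ∀ (B : H →L[ℂ] H) (A : traceClass G), E (leftMul (E' B) A) = leftMul B (E A)
  /-- `E ∘ J = id`. -/
  left_inv : E ∘ₗ J = LinearMap.id
  /-- `Tⁿ = E ∘ Ad_{U_n} ∘ J`. -/
  dilates : ∀ n : ℕ, T ^ n = E ∘ₗ Ad (U n : G →L[ℂ] G) ∘ₗ J

end Operators

section Tensor

variable {H K : Type*}
  [NormedAddCommGroup H] [InnerProductSpace ℂ H] [CompleteSpace H]
  [NormedAddCommGroup K] [InnerProductSpace ℂ K] [CompleteSpace K]

/-- The Hilbert space tensor product: the completion of the algebraic one. -/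
abbrev HTensor (H K : Type*) [NormedAddCommGroup H] [InnerProductSpace ℂ H]
    [NormedAddCommGroup K] [InnerProductSpace ℂ K] : Type _ :=
  UniformSpace.Completion (H ⊗[ℂ] K)

/-- The tensor product `A ⊗ B` of bounded operators. -/
def opTensor (A : H →L[ℂ] H) (B : K →L[ℂ] K) : HTensor H K →L[ℂ] HTensor H K :=
  (TensorProduct.mapL A B).completion

/-- The pure tensor `x ⊗ y` in the Hilbert space tensor product. -/
def htmul (x : H) (y : K) : HTensor H K := ((x ⊗ₜ[ℂ] y : H ⊗[ℂ] K) : HTensor H K)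

theorem opTensor_htmul (A : H →L[ℂ] H) (B : K →L[ℂ] K) (x : H) (y : K) :
    opTensor A B (htmul x y) = htmul (A x) (B y) := by
  simp [opTensor, htmul]

theorem inner_htmul (x x' : H) (y y' : K) :
    ⟪htmul x y, htmul x' y'⟫_ℂ = ⟪x, x'⟫_ℂ * ⟪y, y'⟫_ℂ := by
  simp [htmul]

theorem enorm_htmul (x : H) (y : K) : ‖htmul x y‖ₑ = ‖x‖ₑ * ‖y‖ₑ := by
  simp [htmul]

theorem htensor_induction {P : HTensor H K → Prop} (hc : IsClosed {z | P z})
    (h0 : P 0) (ht : ∀ x y, P (htmul x y)) (ha : ∀ u v, P u → P v → P (u + v)) (z) : P z := by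
  induction z using UniformSpace.Completion.induction_on with
  | hp => exact hc
  | ih z =>
    induction z using TensorProduct.induction_on with
    | zero => exact UniformSpace.Completion.coe_zero (α := H ⊗[ℂ] K) ▸ h0
    | tmul x y => exact ht x y
    | add a b iha ihb => rw [UniformSpace.Completion.coe_add]; exact ha _ _ iha ihb

theorem opTensor_ext {C D : HTensor H K →L[ℂ] HTensor H K}
    (h : ∀ (x : H) (y : K), C (htmul x y) = D (htmul x y)) : C = D := by
  ext z
  induction z using htensor_induction with
  | hc => exact isClosed_eq C.continuous D.continuous
  | h0 => rw [map_zero, map_zero]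
  | ht x y => exact h x y
  | ha a b ha hb => rw [map_add, map_add, ha, hb]

theorem opTensor_comp (A A' : H →L[ℂ] H) (B B' : K →L[ℂ] K) :
    opTensor (A ∘L A') (B ∘L B') = opTensor A B ∘L opTensor A' B' :=
  opTensor_ext fun x y => by
    simp only [ContinuousLinearMap.comp_apply, opTensor_htmul]

theorem adjoint_opTensor (A : H →L[ℂ] H) (B : K →L[ℂ] K) :
    ContinuousLinearMap.adjoint (opTensor A B) =
      opTensor (ContinuousLinearMap.adjoint A) (ContinuousLinearMap.adjoint B) := by
  symm
  rw [ContinuousLinearMap.eq_adjoint_iff]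
  intro u v
  induction u using htensor_induction with
  | hc => exact isClosed_eq (by fun_prop) (by fun_prop)
  | h0 => rw [map_zero, inner_zero_left, inner_zero_left]
  | ha a b ha hb => rw [map_add, inner_add_left, inner_add_left, ha, hb]
  | ht x y =>
    induction v using htensor_induction with
    | hc => exact isClosed_eq (by fun_prop) (by fun_prop)
    | h0 => rw [map_zero, inner_zero_right, inner_zero_right]
    | ha a b ha hb => rw [map_add, inner_add_right, inner_add_right, ha, hb]
    | ht x' y' =>
      simp only [opTensor_htmul, inner_htmul, ContinuousLinearMap.adjoint_inner_left]

theorem htmul_add_left (x x' : H) (y : K) : htmul (x + x') y = htmul x y + htmul x' y := by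
  simp only [htmul, TensorProduct.add_tmul, UniformSpace.Completion.coe_add]

theorem htmul_smul_left (a : ℂ) (x : H) (y : K) : htmul (a • x) y = a • htmul x y := by
  rw [htmul, htmul, ← TensorProduct.smul_tmul', UniformSpace.Completion.coe_smul]

theorem basis_ext {ι : Type*} (b : HilbertBasis ι ℂ H) {x : H} (h : ∀ i, ⟪b i, x⟫_ℂ = 0) :
    x = 0 := by
  have h1 := b.hasSum_repr x
  simp only [b.repr_apply_apply, h, zero_smul] at h1
  exact h1.unique hasSum_zero

/-- The product basis of `H ⊗ K`. -/
theorem exists_tensorBasis {ι κ : Type*} (b : HilbertBasis ι ℂ H) (c : HilbertBasis κ ℂ K) :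
    ∃ d : HilbertBasis (ι × κ) ℂ (HTensor H K), ∀ p, d p = htmul (b p.1) (c p.2) := by
  have ho : Orthonormal ℂ fun p : ι × κ => htmul (b p.1) (c p.2) :=
    (b.orthonormal.tmul c.orthonormal).comp_linearIsometry UniformSpace.Completion.toComplₗᵢ
  have hz : (Submodule.span ℂ (Set.range fun p : ι × κ => htmul (b p.1) (c p.2)))ᗮ = ⊥ := by
    rw [Submodule.eq_bot_iff]
    intro z hz
    have h1 : ∀ i j, ⟪htmul (b i) (c j), z⟫_ℂ = 0 :=
      fun i j => hz _ (Submodule.subset_span ⟨(i, j), rfl⟩)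
    let L : H →L[ℂ] K →L[ℂ] HTensor H K :=
      (ContinuousLinearMap.compL ℂ K (H ⊗[ℂ] K) (HTensor H K)
        UniformSpace.Completion.toComplL) ∘L TensorProduct.mkL ℂ H K
    have hL : ∀ x y, L x y = htmul x y := fun x y => rfl
    have h2 : ∀ x y, ⟪htmul x y, z⟫_ℂ = 0 := by
      intro x y
      have hx : ∀ i, ContinuousLinearMap.adjoint (L (b i)) z = 0 := fun i =>
        basis_ext c fun j => by rw [ContinuousLinearMap.adjoint_inner_right, hL, h1]
      have hy : ContinuousLinearMap.adjoint (L.flip y) z = 0 :=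
        basis_ext b fun i => by
          rw [ContinuousLinearMap.adjoint_inner_right, ContinuousLinearMap.flip_apply,
            ← ContinuousLinearMap.adjoint_inner_right, hx, inner_zero_right]
      rw [← hL, ← ContinuousLinearMap.flip_apply, ← ContinuousLinearMap.adjoint_inner_right, hy,
        inner_zero_right]
    have h4 : ∀ u : HTensor H K, ⟪u, z⟫_ℂ = 0 := by
      intro u
      induction u using htensor_induction with
      | hc => exact isClosed_eq (by fun_prop) continuous_const
      | h0 => exact inner_zero_left _
      | ht x y => exact h2 x y
      | ha a b ha hb => rw [inner_add_left, ha, hb, add_zero]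
    exact inner_self_eq_zero.1 (h4 z)
  exact ⟨HilbertBasis.mkOfOrthogonalEqBot ho hz, fun p => by
    rw [HilbertBasis.coe_mkOfOrthogonalEqBot]⟩

theorem IsTraceClass.opTensor {A : H →L[ℂ] H} {B : K →L[ℂ] K} (hA : IsTraceClass A)
    (hB : IsTraceClass B) : IsTraceClass (opTensor A B) := by
  obtain ⟨X, Y, rfl, h⟩ := hA.exists_factor
  obtain ⟨X', Y', rfl, h'⟩ := hB.exists_factor
  obtain ⟨d, hd⟩ := exists_tensorBasis (stdBasis H) (stdBasis K)
  have hs : ∀ (X : H →L[ℂ] H) (X' : K →L[ℂ] K), hsSum (stdBasis H) X ≠ ⊤ →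
      hsSum (stdBasis K) X' ≠ ⊤ → hsSum d (QuantumDilation.opTensor X X') ≠ ⊤ := by
    intro X X' hX hX'
    have : hsSum d (QuantumDilation.opTensor X X') =
        hsSum (stdBasis H) X * hsSum (stdBasis K) X' := by
      unfold hsSum
      rw [ENNReal.tsum_prod', ← ENNReal.tsum_mul_right]
      refine tsum_congr fun i => ?_
      rw [← ENNReal.tsum_mul_left]
      refine tsum_congr fun j => ?_
      rw [hd, opTensor_htmul, ← mul_pow, enorm_htmul]
    rw [this]
    exact ENNReal.mul_ne_top hX hX'
  rw [opTensor_comp, ← adjoint_opTensor]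
  exact isTraceClass_of_factor d _ _ (hs _ _ (h _).1 (h' _).1) (hs _ _ (h _).2 (h' _).2)

/-- The extension `i_ω : B¹(H) → B¹(H ⊗ K)`, `A ↦ A ⊗ ω`. -/
def tensorRight (ω : traceClass K) : traceClass H →ₗ[ℂ] traceClass (HTensor H K) where
  toFun A := ⟨opTensor (A : H →L[ℂ] H) (ω : K →L[ℂ] K), IsTraceClass.opTensor A.2 ω.2⟩
  map_add' A A' := Subtype.ext <| opTensor_ext fun x y => by
    simp [opTensor_htmul, htmul_add_left]
  map_smul' a A := Subtype.ext <| opTensor_ext fun x y => by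
    simp [opTensor_htmul, htmul_smul_left]

/-- `E` is the partial trace `tr_K : B¹(H ⊗ K) → B¹(H)`, which is defined by
`tr(B tr_K(A)) = tr((B ⊗ id_K) A)` for all `B ∈ B(H)` and `A ∈ B¹(H ⊗ K)`. -/
def IsPartialTrace (E : traceClass (HTensor H K) →ₗ[ℂ] traceClass H) : Prop :=
  ∀ (B : H →L[ℂ] H) (A : traceClass (HTensor H K)),
    trace (B ∘L (E A : H →L[ℂ] H)) =
      trace (opTensor B (ContinuousLinearMap.id ℂ K) ∘L (A : HTensor H K →L[ℂ] HTensor H K))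

/-- The defining equation determines the partial trace. -/
theorem IsPartialTrace.unique {E E' : traceClass (HTensor H K) →ₗ[ℂ] traceClass H}
    (h : IsPartialTrace E) (h' : IsPartialTrace E') : E = E' := by
  ext A : 2
  refine ContinuousLinearMap.ext fun y => ext_inner_left ℂ fun x => ?_
  rw [← trace_rankOne_comp, ← trace_rankOne_comp, h, h']

end Tensor

end QuantumDilation

end

/-!
A completely positive map `T` on `B¹(H)` has the positive semidefinite operator-valued kernel
`(x, x') ↦ T(|x⟩⟨x'|)`.  Its reproducing kernel Hilbert space carries a Stinespring map `Ψ` with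
`⟨y, T(|x⟩⟨x'|) y'⟩ = ⟨Ψ x y, Ψ x' y'⟩` (`IsSchrodingerChannel.exists_stinespring`), and the
coordinates of `Ψ` in an orthonormal basis are Kraus operators `M_k` of `T`
(`IsSchrodingerChannel.exists_isKrausFamily`).  The Kraus formula passes from the `|x⟩⟨x|` to all
positive trace-class operators because a positive trace-preserving map is normal along
`R† R = ∑ |R† b_i⟩⟨R† b_i|` (`quadForm_map_adjoint_comp_self`).  Preservation of the trace gives
`∑ ‖M_k x‖² = ‖x‖²`.

Let `K = ℓ²(ℕ)` with basis `(c_u)`.  Reading a natural number as a history of outcomes, with `0` the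
empty history and `⟨k, u⟩ + 1` the history `u` followed by the outcome `k`, the isometry
`W (x ⊗ c_u) = ∑ M_k x ⊗ c_{⟨k, u⟩ + 1}` of `H ⊗ K` applies one step of the channel and writes its
outcome into a fresh history.  Different histories are orthogonal, so tracing out `K` from
`Wⁿ (A ⊗ |c_0⟩⟨c_0|) (W†)ⁿ` produces `Tⁿ A`: no memory of the outcomes acts back on `H`.

It remains to replace `W` by a unitary.  With the isometries `S₀, S₁` that move `c_u` to `c_{2u}`
and `c_{2u+1}`, the space `H ⊗ K` is the orthogonal sum of two copies of itself, on which the Halmos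
matrix of `W`, with rows `(W, 1 - W W†)` and `(0, W†)`, is a unitary `V` with `V S₀ = S₀ W`
(`exists_unitary_mul_eq`).  Hence `Vⁿ (x ⊗ c_0) = S₀ Wⁿ (x ⊗ c_0)`, and relabelling the basis
by `S₀` does not affect the partial trace (`exists_unitary_dilating`).

Identities between positive operators are compared through their quadratic forms with values in
`[0, ∞]`, where double sums may be interchanged freely, and extend to all trace-class operators by
polarization (`ext_of_isPositive`).
-/

noncomputable section

namespace QuantumDilation

open ContinuousLinearMap InnerProductSpace

/-! ### The trace and positive trace-class operators -/

section Trace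

variable {H G : Type*}
  [NormedAddCommGroup H] [InnerProductSpace ℂ H] [CompleteSpace H]
  [NormedAddCommGroup G] [InnerProductSpace ℂ G] [CompleteSpace G]

theorem summable_inner_mul_inner_prod {ι κ : Type*} (b : HilbertBasis ι ℂ H)
    (c : HilbertBasis κ ℂ G) (X Y : H →L[ℂ] G) (hX : hsSum b X ≠ ⊤) (hY : hsSum b Y ≠ ⊤) :
    Summable fun p : ι × κ => ⟪X (b p.1), c p.2⟫_ℂ * ⟪c p.2, Y (b p.1)⟫_ℂ := by
  have key : ∀ Z : H →L[ℂ] G, hsSum b Z ≠ ⊤ →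
      Summable fun p : ι × κ => ‖⟪c p.2, Z (b p.1)⟫_ℂ‖ ^ 2 := by
    intro Z hZ
    have h : ∑' p : ι × κ, ‖⟪c p.2, Z (b p.1)⟫_ℂ‖ₑ ^ 2 ≠ ⊤ := by
      rw [ENNReal.tsum_prod' (f := fun p : ι × κ => ‖⟪c p.2, Z (b p.1)⟫_ℂ‖ₑ ^ 2)]
      simp only [← parseval c]
      exact hZ
    simpa using ENNReal.summable_toReal h
  refine Summable.of_norm_bounded ((key X hX).add (key Y hY)) fun p => ?_
  rw [norm_mul, norm_inner_symm (X _)]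
  nlinarith [sq_nonneg (‖⟪c p.2, X (b p.1)⟫_ℂ‖ - ‖⟪c p.2, Y (b p.1)⟫_ℂ‖),
    sq_nonneg ‖⟪c p.2, X (b p.1)⟫_ℂ‖, sq_nonneg ‖⟪c p.2, Y (b p.1)⟫_ℂ‖]

/-- Cyclicity `tr (X† Y) = tr (Y X†)` for Hilbert-Schmidt operators, with the two traces computed
in unrelated bases. It makes the trace independent of the basis. -/
theorem tsum_inner_hilbertSchmidt {ι κ : Type*} (b : HilbertBasis ι ℂ H) (c : HilbertBasis κ ℂ G)
    (X Y : H →L[ℂ] G) (hX : hsSum b X ≠ ⊤) (hY : hsSum b Y ≠ ⊤) :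
    ∑' i, ⟪X (b i), Y (b i)⟫_ℂ = ∑' j, ⟪adjoint Y (c j), adjoint X (c j)⟫_ℂ := by
  have h1 : ∀ i, ⟪X (b i), Y (b i)⟫_ℂ = ∑' j, ⟪X (b i), c j⟫_ℂ * ⟪c j, Y (b i)⟫_ℂ :=
    fun i => (c.tsum_inner_mul_inner _ _).symm
  have h2 : ∀ j, ⟪adjoint Y (c j), adjoint X (c j)⟫_ℂ =
      ∑' i, ⟪X (b i), c j⟫_ℂ * ⟪c j, Y (b i)⟫_ℂ := fun j => by
    rw [← b.tsum_inner_mul_inner]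
    refine tsum_congr fun i => ?_
    rw [adjoint_inner_left, adjoint_inner_right, mul_comm]
  simp_rw [h1, h2]
  exact (Summable.tsum_comm (f := fun i j => ⟪X (b i), c j⟫_ℂ * ⟪c j, Y (b i)⟫_ℂ)
    (summable_inner_mul_inner_prod b c X Y hX hY)).symm

/-- The trace may be computed in any orthonormal basis. -/
theorem IsTraceClass.hasSum_trace {A : H →L[ℂ] H} (hA : IsTraceClass A) {ι : Type*}
    (b : HilbertBasis ι ℂ H) : HasSum (fun i => ⟪b i, A (b i)⟫_ℂ) (trace A) := by
  have h0 := (hA.summable b).hasSum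
  convert h0 using 1
  obtain ⟨X, Y, rfl, h⟩ := hA.exists_factor
  have hb : ∀ Z : H →L[ℂ] H, hsSum (stdBasis H) Z ≠ ⊤ → hsSum b Z ≠ ⊤ := fun Z hZ => by
    rwa [hsSum_basis b (stdBasis H)]
  simp only [trace, comp_apply, adjoint_inner_right]
  rw [tsum_inner_hilbertSchmidt b (stdBasis H) X Y (hb _ (h _).1) (hb _ (h _).2),
    tsum_inner_hilbertSchmidt (stdBasis H) (stdBasis H) X Y (h _).1 (h _).2]

theorem isTraceClass_rankOne (x y : H) : IsTraceClass (rankOne ℂ x y) :=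
  isTraceClass_of_summable (stdBasis H) fun W => by
    simpa only [rankOne_apply, map_smul, inner_smul_right] using
      (stdBasis H).summable_inner_mul_inner y (W x)

/-- The trace-class operator `|x⟩⟨y|`. -/
def ketBra (x y : H) : traceClass H := ⟨rankOne ℂ x y, isTraceClass_rankOne x y⟩

theorem coe_ketBra (x y : H) : (ketBra x y : H →L[ℂ] H) = rankOne ℂ x y := rfl

theorem trace_rankOne (x y : H) : trace (rankOne ℂ x y : H →L[ℂ] H) = ⟪y, x⟫_ℂ := by
  have := trace_rankOne_comp (ContinuousLinearMap.id ℂ H) y x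
  simpa using this

theorem trace_rankOne_self (x : H) : trace (rankOne ℂ x x : H →L[ℂ] H) = ((‖x‖ ^ 2 : ℝ) : ℂ) := by
  rw [trace_rankOne, inner_self_eq_norm_sq_to_K]
  norm_cast

theorem trace_sub (A B : traceClass H) :
    trace ((A - B : traceClass H) : H →L[ℂ] H) = trace (A : H →L[ℂ] H) - trace (B : H →L[ℂ] H) := by
  rw [trace, trace, trace, ← (A.2.summable _).tsum_sub (B.2.summable _)]
  simp

theorem trace_sum {ι : Type*} (s : Finset ι) (A : ι → traceClass H) :
    trace ((∑ i ∈ s, A i : traceClass H) : H →L[ℂ] H) = ∑ i ∈ s, trace (A i : H →L[ℂ] H) := by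
  simp only [trace]
  rw [← Summable.tsum_finsetSum fun i _ => (A i).2.summable _]
  simp

theorem isPositive_iff_inner_nonneg (A : H →L[ℂ] H) :
    A.IsPositive ↔ ∀ x, 0 ≤ ⟪x, A x⟫_ℂ := by
  rw [isPositive_iff_complex]
  constructor
  · intro h x
    have hx := h x
    have h2 : 0 ≤ ⟪A x, x⟫_ℂ := by
      rw [← hx.1]
      exact_mod_cast hx.2
    rw [← inner_conj_symm]
    exact star_nonneg_iff.2 h2
  · intro h x
    have h2 : 0 ≤ ⟪A x, x⟫_ℂ := by
      rw [← inner_conj_symm]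
      exact star_nonneg_iff.2 (h x)
    rw [Complex.nonneg_iff] at h2
    exact ⟨Complex.ext rfl h2.2, h2.1⟩

theorem exists_adjoint_comp_self {A : H →L[ℂ] H} (hA : A.IsPositive) :
    ∃ R : H →L[ℂ] H, A = adjoint R ∘L R := by
  have h0 : 0 ≤ A := (nonneg_iff_isPositive A).2 hA
  refine ⟨CFC.sqrt A, ?_⟩
  have h1 : adjoint (CFC.sqrt A) = CFC.sqrt A := (CFC.sqrt_nonneg A).isSelfAdjoint.star_eq
  rw [h1]
  exact (CFC.sqrt_mul_sqrt_self A h0).symm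

theorem inner_adjoint_comp_self (R : H →L[ℂ] G) (y : H) :
    ⟪y, (adjoint R ∘L R) y⟫_ℂ = ((‖R y‖ ^ 2 : ℝ) : ℂ) := by
  rw [comp_apply, adjoint_inner_right, inner_self_eq_norm_sq_to_K]
  norm_cast

/-- The quadratic form `⟨y, A y⟩` of a positive operator, as an extended nonnegative number.
For an operator that is not positive it carries no information. -/
def quadForm (A : H →L[ℂ] H) (y : H) : ℝ≥0∞ := ENNReal.ofReal (⟪y, A y⟫_ℂ).re

theorem quadForm_adjoint_comp_self (R : H →L[ℂ] G) (y : H) :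
    quadForm (adjoint R ∘L R) y = ‖R y‖ₑ ^ 2 := by
  rw [quadForm, inner_adjoint_comp_self, Complex.ofReal_re, ENNReal.ofReal_pow (norm_nonneg _),
    ofReal_norm]

theorem quadForm_rankOne (x y : H) : quadForm (rankOne ℂ x x) y = ‖⟪x, y⟫_ℂ‖ₑ ^ 2 := by
  rw [quadForm, rankOne_apply, inner_smul_right, ← inner_conj_symm y x, Complex.mul_conj,
    Complex.ofReal_re, Complex.normSq_eq_norm_sq, ENNReal.ofReal_pow (norm_nonneg _), ofReal_norm]

theorem ofReal_quadForm {A : H →L[ℂ] H} (hA : A.IsPositive) (y : H) :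
    ((quadForm A y).toReal : ℂ) = ⟪y, A y⟫_ℂ := by
  have h := (isPositive_iff_inner_nonneg A).1 hA y
  rw [Complex.nonneg_iff] at h
  rw [quadForm, ENNReal.toReal_ofReal h.1]
  exact Complex.ext rfl h.2

theorem IsPositive.ext_quadForm {A B : H →L[ℂ] H} (hA : A.IsPositive) (hB : B.IsPositive)
    (h : ∀ y, quadForm A y = quadForm B y) : A = B := by
  apply coe_injective
  rw [← ext_inner_map]
  intro y
  rw [← inner_conj_symm, ← inner_conj_symm _ y]
  congr 1
  change ⟪y, A y⟫_ℂ = ⟪y, B y⟫_ℂ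
  rw [← ofReal_quadForm hA, ← ofReal_quadForm hB, h]

theorem tsum_quadForm {A : H →L[ℂ] H} (hA : A.IsPositive) (ht : IsTraceClass A) {ι : Type*}
    (b : HilbertBasis ι ℂ H) : ∑' i, quadForm A (b i) = ENNReal.ofReal (trace A).re := by
  have h := Complex.hasSum_re (ht.hasSum_trace b)
  rw [← h.tsum_eq, ENNReal.ofReal_tsum_of_nonneg _ h.summable]
  · rfl
  · intro i
    exact (Complex.nonneg_iff.1 ((isPositive_iff_inner_nonneg A).1 hA (b i))).1

theorem enorm_apply_sq_le_hsSum {ι : Type*} (b : HilbertBasis ι ℂ H) (R : H →L[ℂ] G) (y : H) :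
    ‖R y‖ₑ ^ 2 ≤ hsSum b R * ‖y‖ₑ ^ 2 := by
  rw [parseval (stdBasis G) (R y), hsSum_adjoint b (stdBasis G), hsSum, ← ENNReal.tsum_mul_right]
  refine ENNReal.tsum_le_tsum fun i => ?_
  rw [← adjoint_inner_left, ← mul_pow]
  gcongr
  rw [← ofReal_norm, ← ofReal_norm, ← ofReal_norm, ← ENNReal.ofReal_mul (norm_nonneg _)]
  exact ENNReal.ofReal_le_ofReal (norm_inner_le_norm _ _)

theorem quadForm_le_trace {A : H →L[ℂ] H} (hA : A.IsPositive) (ht : IsTraceClass A) (y : H) :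
    quadForm A y ≤ ENNReal.ofReal (trace A).re * ‖y‖ₑ ^ 2 := by
  obtain ⟨R, rfl⟩ := exists_adjoint_comp_self hA
  rw [← tsum_quadForm hA ht (stdBasis H)]
  simp_rw [quadForm_adjoint_comp_self]
  exact enorm_apply_sq_le_hsSum (stdBasis H) R y

theorem hsSum_add_ne_top {ι : Type*} (b : HilbertBasis ι ℂ H) {X Y : H →L[ℂ] G}
    (hX : hsSum b X ≠ ⊤) (hY : hsSum b Y ≠ ⊤) : hsSum b (X + Y) ≠ ⊤ := by
  have hle : hsSum b (X + Y) ≤ 2 * (hsSum b X + hsSum b Y) := by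
    unfold hsSum
    rw [← ENNReal.tsum_add, ← ENNReal.tsum_mul_left]
    refine ENNReal.tsum_le_tsum fun i => ?_
    calc ‖(X + Y) (b i)‖ₑ ^ 2 ≤ (‖X (b i)‖ₑ + ‖Y (b i)‖ₑ) ^ 2 := by
          gcongr
          exact enorm_add_le _ _
      _ ≤ 2 * (‖X (b i)‖ₑ ^ 2 + ‖Y (b i)‖ₑ ^ 2) := by
          have h := ENNReal.rpow_add_le_mul_rpow_add_rpow ‖X (b i)‖ₑ ‖Y (b i)‖ₑ one_le_two
          norm_num at h
          exact h
  exact ne_top_of_le_ne_top (ENNReal.mul_ne_top (by simp) (ENNReal.add_ne_top.2 ⟨hX, hY⟩)) hle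

/-- Polarization: linear maps that agree on the positive trace-class operators are equal. -/
theorem ext_of_isPositive {S T : traceClass H →ₗ[ℂ] traceClass G}
    (h : ∀ A : traceClass H, (A : H →L[ℂ] H).IsPositive → S A = T A) : S = T := by
  refine LinearMap.ext fun A => ?_
  obtain ⟨X, Y, hXY, hs⟩ := IsTraceClass.exists_factor A.2
  -- `A = X† Y` is a combination of the operators `P z` at the fourth roots of unity.
  let P : ℂ → H →L[ℂ] H := fun z => adjoint (X + z • Y) ∘L (X + z • Y)
  have ht : ∀ z, IsTraceClass (P z) := by
    intro z
    have h1 : hsSum (stdBasis H) (X + z • Y) ≠ ⊤ := by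
      refine hsSum_add_ne_top _ (hs _).1 ?_
      convert hsSum_comp_left (stdBasis H) Y (z • ContinuousLinearMap.id ℂ H) (hs _).2 using 2
      ext x
      simp
    exact isTraceClass_of_factor (stdBasis H) _ _ h1 h1
  have hp : ∀ z, S ⟨P z, ht z⟩ = T ⟨P z, ht z⟩ := fun z =>
    h _ (isPositive_adjoint_comp_self _)
  have hA : A = (4⁻¹ : ℂ) • ((⟨P 1, ht 1⟩ : traceClass H) - ⟨P (-1), ht (-1)⟩ -
      Complex.I • (⟨P Complex.I, ht _⟩ - ⟨P (-Complex.I), ht _⟩)) := by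
    refine Subtype.ext ?_
    simp only [Submodule.coe_smul, Submodule.coe_sub, P, hXY]
    refine ContinuousLinearMap.ext fun x => ?_
    simp only [map_add, map_smulₛₗ, smul_apply, sub_apply, comp_apply, add_apply, Complex.conj_I,
      map_neg, map_one]
    match_scalars <;> ring_nf
    all_goals norm_num [Complex.I_sq]
  rw [hA]
  simp only [map_smul, map_sub, hp]

end Trace

/-! ### Kraus operators of a channel -/

section Kraus

universe u v

variable {H : Type u} {G : Type v}
  [NormedAddCommGroup H] [InnerProductSpace ℂ H] [CompleteSpace H]
  [NormedAddCommGroup G] [InnerProductSpace ℂ G] [CompleteSpace G]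

theorem countable_hilbertBasis [TopologicalSpace.SeparableSpace H] {ι : Type*}
    (b : HilbertBasis ι ℂ H) : Countable ι := by
  have hd : Set.univ.PairwiseDisjoint fun i => Metric.ball (b i) (1 / 2) := by
    intro i _ j _ hij
    refine Metric.ball_disjoint_ball ?_
    have h1 : ‖b i - b j‖ ^ 2 = 2 := by
      rw [@norm_sub_sq ℂ, b.orthonormal.2 hij, b.orthonormal.1, b.orthonormal.1]
      norm_num
    rw [dist_eq_norm]
    nlinarith [norm_nonneg (b i - b j)]
  exact Set.countable_univ_iff.1 (hd.countable_of_isOpen (fun i _ => Metric.isOpen_ball)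
    fun i _ => ⟨b i, Metric.mem_ball_self (by norm_num)⟩)

theorem IsCompletelyPositive.fintype {T : traceClass H →ₗ[ℂ] traceClass G}
    (hT : IsCompletelyPositive T) {ι : Type*} [Fintype ι] (A : ι → ι → traceClass H)
    (hA : ∀ x : ι → H, 0 ≤ ∑ i, ∑ j, ⟪x i, (A i j : H →L[ℂ] H) (x j)⟫_ℂ) (y : ι → G) :
    0 ≤ ∑ i, ∑ j, ⟪y i, (T (A i j) : G →L[ℂ] G) (y j)⟫_ℂ := by
  let e := Fintype.equivFin ι
  have h := hT _ (fun i j => A (e.symm i) (e.symm j)) (fun x => by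
    have h1 := hA (x ∘ e)
    rw [← e.symm.sum_comp] at h1
    simp_rw [← e.symm.sum_comp (fun j => ⟪_, (A _ j : H →L[ℂ] H) ((x ∘ e) j)⟫_ℂ)] at h1
    simpa using h1) (y ∘ e.symm)
  rw [← e.symm.sum_comp]
  simp_rw [← e.symm.sum_comp (fun j => ⟪_, (T (A _ j) : G →L[ℂ] G) (y j)⟫_ℂ)]
  exact h

theorem IsCompletelyPositive.isPositive {T : traceClass H →ₗ[ℂ] traceClass G}
    (hT : IsCompletelyPositive T) {A : traceClass H} (hA : (A : H →L[ℂ] H).IsPositive) :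
    (T A : G →L[ℂ] G).IsPositive := by
  rw [isPositive_iff_inner_nonneg] at hA ⊢
  intro y
  simpa using hT 1 (fun _ _ => A) (fun x => by simpa using hA (x 0)) fun _ => y

theorem IsCompletelyPositive.ketBra_sum_nonneg {T : traceClass H →ₗ[ℂ] traceClass G}
    (hT : IsCompletelyPositive T) {ι : Type*} [Fintype ι] (x : ι → H) (y : ι → G) :
    0 ≤ ∑ i, ∑ j, ⟪y i, (T (ketBra (x i) (x j)) : G →L[ℂ] G) (y j)⟫_ℂ := by
  refine hT.fintype _ (fun z => ?_) y
  have h : ∑ i, ∑ j, ⟪z i, (ketBra (x i) (x j) : H →L[ℂ] H) (z j)⟫_ℂ =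
      star (∑ i, ⟪x i, z i⟫_ℂ) * ∑ i, ⟪x i, z i⟫_ℂ := by
    simp only [coe_ketBra, rankOne_apply, inner_smul_right, star_sum, Finset.sum_mul_sum]
    refine Finset.sum_congr rfl fun i _ => Finset.sum_congr rfl fun j _ => ?_
    rw [mul_comm, ← inner_conj_symm (z i)]
    rfl
  rw [h]
  exact star_mul_self_nonneg _

/-- By polarization, since `T` maps the operators `|z⟩⟨z|` to self-adjoint ones. -/
theorem adjoint_map_ketBra {T : traceClass H →ₗ[ℂ] traceClass G}
    (hT : IsCompletelyPositive T) (x x' : H) :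
    adjoint (T (ketBra x x') : G →L[ℂ] G) = (T (ketBra x' x) : G →L[ℂ] G) := by
  have hp : ∀ x, adjoint (T (ketBra x x) : G →L[ℂ] G) = (T (ketBra x x) : G →L[ℂ] G) := fun x =>
    (hT.isPositive (A := ketBra x x) (isPositive_rankOne_self x)).isSelfAdjoint.adjoint_eq
  have pol : ∀ x x' : H, ketBra x x' = (4⁻¹ : ℂ) • (ketBra (x + x') (x + x') -
      ketBra (x - x') (x - x') + Complex.I • (ketBra (x + Complex.I • x') (x + Complex.I • x') -
      ketBra (x - Complex.I • x') (x - Complex.I • x'))) := by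
    intro x x'
    refine Subtype.ext (ContinuousLinearMap.ext fun z => ?_)
    simp only [Submodule.coe_smul, Submodule.coe_sub, Submodule.coe_add, coe_ketBra, smul_apply,
      sub_apply, add_apply, rankOne_apply, inner_add_left, inner_sub_left, inner_smul_left,
      Complex.conj_I]
    match_scalars <;> (ring_nf; simp; try ring_nf)
  have pol' : ∀ x x' : H, ketBra x' x = (4⁻¹ : ℂ) • (ketBra (x + x') (x + x') -
      ketBra (x - x') (x - x') - Complex.I • (ketBra (x + Complex.I • x') (x + Complex.I • x') -
      ketBra (x - Complex.I • x') (x - Complex.I • x'))) := by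
    intro x x'
    refine Subtype.ext (ContinuousLinearMap.ext fun z => ?_)
    simp only [Submodule.coe_smul, Submodule.coe_sub, coe_ketBra, smul_apply,
      sub_apply, rankOne_apply, inner_add_left, inner_sub_left, inner_smul_left, Complex.conj_I]
    match_scalars <;> (ring_nf; simp; try ring_nf)
  rw [pol x x', pol' x x']
  simp only [map_smul, map_sub, map_add, Submodule.coe_smul, Submodule.coe_sub, Submodule.coe_add,
    map_smulₛₗ, hp, Complex.conj_I, map_inv₀, map_ofNat]
  module

/-- The operator-valued kernel `(x, x') ↦ T(|x⟩⟨x'|)`. -/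
def channelKernel (T : traceClass H →ₗ[ℂ] traceClass G) : Matrix H H (G →L[ℂ] G) :=
  .of fun x x' => (T (ketBra x x') : G →L[ℂ] G)

theorem posSemidef_channelKernel {T : traceClass H →ₗ[ℂ] traceClass G}
    (hT : IsCompletelyPositive T) : (channelKernel T).PosSemidef := by
  have tfae := (RKHS.posSemidef_tfae (K := channelKernel T)).out 2 0
  refine tfae.1 ⟨?_, fun v => ?_⟩
  · ext1 x x'
    exact adjoint_map_ketBra hT x' x
  · have h := hT.ketBra_sum_nonneg (fun i : v.support => (i : H)) (fun i : v.support => v i)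
    have h2 : 0 ≤ (∑ i : v.support, ∑ j : v.support,
        ⟪v i, (T (ketBra (i : H) j) : G →L[ℂ] G) (v j)⟫_ℂ).re := (Complex.nonneg_iff.1 h).1
    convert h2 using 1
    simp only [Finsupp.sum, map_sum, Complex.re_sum, channelKernel, Matrix.of_apply]
    rw [← Finset.sum_coe_sort v.support, Finset.sum_comm]
    rw [← Finset.sum_coe_sort v.support]
    refine Finset.sum_congr rfl fun i _ => Finset.sum_congr rfl fun j _ => ?_
    exact inner_re_symm (𝕜 := ℂ) _ _

theorem quadForm_add {A B : H →L[ℂ] H} (hA : A.IsPositive) (hB : B.IsPositive) (y : H) :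
    quadForm (A + B) y = quadForm A y + quadForm B y := by
  rw [quadForm, add_apply, inner_add_right, Complex.add_re, ENNReal.ofReal_add
    (Complex.nonneg_iff.1 ((isPositive_iff_inner_nonneg A).1 hA y)).1
    (Complex.nonneg_iff.1 ((isPositive_iff_inner_nonneg B).1 hB y)).1]
  rfl

theorem isPositive_finsetSum {ι : Type*} (s : Finset ι) {A : ι → H →L[ℂ] H}
    (hA : ∀ i, (A i).IsPositive) : (∑ i ∈ s, A i).IsPositive := by
  classical
  induction s using Finset.induction_on with
  | empty => simp
  | insert i s hi ih => rw [Finset.sum_insert hi]; exact (hA i).add ih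

theorem quadForm_finsetSum {ι : Type*} (s : Finset ι) {A : ι → H →L[ℂ] H}
    (hA : ∀ i, (A i).IsPositive) (y : H) :
    quadForm (∑ i ∈ s, A i) y = ∑ i ∈ s, quadForm (A i) y := by
  classical
  induction s using Finset.induction_on with
  | empty => simp [quadForm]
  | insert i s hi ih =>
    rw [Finset.sum_insert hi, Finset.sum_insert hi, quadForm_add (hA i)
      (isPositive_finsetSum s hA), ih]

/-- Normality of a positive trace-preserving map `T` along the decomposition
`R† R = ∑ |R† b_i⟩⟨R† b_i|`: the remainder of a partial sum is a positive operator whose trace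
tends to zero, and the trace of `T D` bounds its quadratic form. -/
theorem quadForm_map_adjoint_comp_self {T : traceClass H →ₗ[ℂ] traceClass G}
    (hp : ∀ A : traceClass H, (A : H →L[ℂ] H).IsPositive → (T A : G →L[ℂ] G).IsPositive)
    (htr : ∀ A : traceClass H, trace (T A : G →L[ℂ] G) = trace (A : H →L[ℂ] H))
    {ι : Type*} (b : HilbertBasis ι ℂ H) {A : traceClass H} (R : H →L[ℂ] H)
    (hR : (A : H →L[ℂ] H) = adjoint R ∘L R) (y : G) :
    quadForm (T A : G →L[ℂ] G) y =
      ∑' i, quadForm (T (ketBra (adjoint R (b i)) (adjoint R (b i))) : G →L[ℂ] G) y := by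
  classical
  set k : ι → traceClass H := fun i => ketBra (adjoint R (b i)) (adjoint R (b i)) with hk
  have hkp : ∀ i, (k i : H →L[ℂ] H).IsPositive := fun i => isPositive_rankOne_self _
  have hAp : (A : H →L[ℂ] H).IsPositive := by
    rw [hR]
    exact isPositive_adjoint_comp_self R
  let D : Finset ι → traceClass H := fun s => A - ∑ i ∈ s, k i
  have hkq : ∀ s : Finset ι, ∀ z, quadForm ((∑ i ∈ s, k i : traceClass H) : H →L[ℂ] H) z =
      ∑ i ∈ s, ‖⟪b i, R z⟫_ℂ‖ₑ ^ 2 := fun s z => by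
    rw [Submodule.coe_sum, quadForm_finsetSum s hkp]
    refine Finset.sum_congr rfl fun i _ => ?_
    rw [coe_ketBra, quadForm_rankOne, adjoint_inner_left]
  have hsp : ∀ s : Finset ι, ((∑ i ∈ s, k i : traceClass H) : H →L[ℂ] H).IsPositive := fun s => by
    rw [Submodule.coe_sum]
    exact isPositive_finsetSum s hkp
  -- Bessel's inequality for `R z`.
  have hD : ∀ s, (D s : H →L[ℂ] H).IsPositive := by
    intro s
    rw [isPositive_iff_inner_nonneg]
    intro z
    have h1 : quadForm ((∑ i ∈ s, k i : traceClass H) : H →L[ℂ] H) z ≤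
        quadForm (A : H →L[ℂ] H) z := by
      rw [hkq, hR, quadForm_adjoint_comp_self, parseval b]
      exact ENNReal.sum_le_tsum s
    have h2 := (ENNReal.toReal_le_toReal (by simp [quadForm]) (by simp [quadForm])).2 h1
    simp only [D, Submodule.coe_sub, sub_apply, inner_sub_right]
    rw [← ofReal_quadForm hAp, ← ofReal_quadForm (hsp s), sub_nonneg]
    exact_mod_cast h2
  have hsplit : ∀ s, quadForm (T A : G →L[ℂ] G) y =
      quadForm (T (D s) : G →L[ℂ] G) y + ∑ i ∈ s, quadForm (T (k i) : G →L[ℂ] G) y := by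
    intro s
    rw [← quadForm_finsetSum s fun i => hp _ (hkp i), ← quadForm_add (hp _ (hD s))
      (isPositive_finsetSum s fun i => hp _ (hkp i)), ← Submodule.coe_sum, ← Submodule.coe_add,
      ← map_sum, ← map_add]
    simp only [D, sub_add_cancel]
  set τ : ℝ≥0∞ := ENNReal.ofReal (trace (A : H →L[ℂ] H)).re with hτ
  have hkt : ∀ i, trace (k i : H →L[ℂ] H) = ((‖adjoint R (b i)‖ ^ 2 : ℝ) : ℂ) := fun i => by
    rw [hk, coe_ketBra, trace_rankOne_self]
  have hsum : ∑' i, ‖adjoint R (b i)‖ₑ ^ 2 = τ := by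
    rw [hτ, ← tsum_quadForm hAp A.2 b]
    simp_rw [hR, quadForm_adjoint_comp_self]
    exact (hsSum_adjoint b b R).symm
  have hrem : ∀ s, ENNReal.ofReal (trace (D s : H →L[ℂ] H)).re =
      τ - ∑ i ∈ s, ‖adjoint R (b i)‖ₑ ^ 2 := by
    intro s
    have h3 : ∀ i, ‖adjoint R (b i)‖ₑ ^ 2 = ENNReal.ofReal (‖adjoint R (b i)‖ ^ 2) := fun i => by
      rw [ENNReal.ofReal_pow (norm_nonneg _), ofReal_norm]
    simp_rw [h3]
    rw [← ENNReal.ofReal_sum_of_nonneg fun i _ => by positivity, hτ,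
      ← ENNReal.ofReal_sub _ (Finset.sum_nonneg fun i _ => by positivity)]
    simp only [D]
    rw [trace_sub, trace_sum]
    simp_rw [hkt]
    rw [← Complex.ofReal_sum, Complex.sub_re, Complex.ofReal_re]
  refine le_antisymm ?_ ?_
  · have hlim : Filter.Tendsto (fun s : Finset ι =>
        (τ - ∑ i ∈ s, ‖adjoint R (b i)‖ₑ ^ 2) * ‖y‖ₑ ^ 2 +
          ∑' i, quadForm (T (k i) : G →L[ℂ] G) y) Filter.atTop
        (nhds ((τ - τ) * ‖y‖ₑ ^ 2 + ∑' i, quadForm (T (k i) : G →L[ℂ] G) y)) := by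
      refine Filter.Tendsto.add ?_ tendsto_const_nhds
      refine ENNReal.Tendsto.mul_const (ENNReal.Tendsto.sub tendsto_const_nhds ?_
        (Or.inl ENNReal.ofReal_ne_top)) (Or.inr (by simp))
      rw [← hsum]
      exact ENNReal.summable.hasSum
    rw [tsub_self, zero_mul, zero_add] at hlim
    refine ge_of_tendsto' hlim fun s => ?_
    rw [hsplit s, ← hrem s, ← htr]
    exact add_le_add (quadForm_le_trace (hp _ (hD s)) (T (D s)).2 y) (ENNReal.sum_le_tsum s)
  · rw [ENNReal.tsum_eq_iSup_sum]
    refine iSup_le fun s => ?_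
    rw [hsplit s]
    exact le_add_self

/-- `M` is a Kraus family of `T`: `T A = ∑ M_k A M_k†` weakly, for positive `A`. -/
def IsKrausFamily {κ : Type*} (M : κ → H →L[ℂ] G) (T : traceClass H →ₗ[ℂ] traceClass G) : Prop :=
  ∀ A : traceClass H, (A : H →L[ℂ] H).IsPositive → ∀ y,
    quadForm (T A : G →L[ℂ] G) y = ∑' k, quadForm (A : H →L[ℂ] H) (adjoint (M k) y)

/-- A trace-preserving completely positive map has the Kraus family `M` as soon as this holds on
the operators `|x⟩⟨x|`. -/
theorem IsSchrodingerChannel.isKrausFamily {T : traceClass H →ₗ[ℂ] traceClass G}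
    (hT : IsSchrodingerChannel T) {κ : Type*} (M : κ → H →L[ℂ] G)
    (h : ∀ x y, quadForm (T (ketBra x x) : G →L[ℂ] G) y = ∑' k, ‖⟪M k x, y⟫_ℂ‖ₑ ^ 2) :
    IsKrausFamily M T := by
  intro A hA y
  obtain ⟨R, hR⟩ := exists_adjoint_comp_self hA
  rw [quadForm_map_adjoint_comp_self (fun _ => hT.1.isPositive) hT.2 (stdBasis H) R hR]
  simp_rw [h]
  rw [ENNReal.tsum_comm]
  refine tsum_congr fun k => ?_
  rw [hR, quadForm_adjoint_comp_self, parseval (stdBasis H)]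
  refine tsum_congr fun i => ?_
  rw [← adjoint_inner_right, adjoint_inner_left]

/-- Preservation of the trace in terms of Kraus operators: `∑ M_k† M_k = id`. -/
theorem IsKrausFamily.tsum_enorm {T : traceClass H →ₗ[ℂ] traceClass G}
    (hT : IsSchrodingerChannel T) {κ : Type*} {M : κ → H →L[ℂ] G} (h : IsKrausFamily M T) (x : H) :
    ∑' k, ‖M k x‖ₑ ^ 2 = ‖x‖ₑ ^ 2 := by
  have hp : (ketBra x x : H →L[ℂ] H).IsPositive := isPositive_rankOne_self x
  have h1 := tsum_quadForm (hT.1.isPositive hp) (T (ketBra x x)).2 (stdBasis G)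
  simp_rw [h _ hp] at h1
  rw [hT.2, coe_ketBra, trace_rankOne_self, ENNReal.tsum_comm] at h1
  convert h1 using 1
  · refine tsum_congr fun k => ?_
    rw [parseval (stdBasis G)]
    refine tsum_congr fun i => ?_
    rw [quadForm_rankOne, adjoint_inner_right, ← ofReal_norm, ← ofReal_norm, norm_inner_symm]
  · rw [Complex.ofReal_re, ENNReal.ofReal_pow (norm_nonneg _), ofReal_norm]

/-- Stinespring form of a channel: `⟨y, T(|x⟩⟨x'|) y'⟩ = ⟨Ψ x y, Ψ x' y'⟩`.
The space is the reproducing kernel Hilbert space of `channelKernel T`. -/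
theorem IsSchrodingerChannel.exists_stinespring {T : traceClass H →ₗ[ℂ] traceClass G}
    (hT : IsSchrodingerChannel T) :
    ∃ (E : Type max u v) (_ : NormedAddCommGroup E) (_ : InnerProductSpace ℂ E)
      (_ : CompleteSpace E) (Ψ : H →L⋆[ℂ] G →L[ℂ] E),
      ∀ x x' y y', ⟪Ψ x y, Ψ x' y'⟫_ℂ = ⟪y, (T (ketBra x x') : G →L[ℂ] G) y'⟫_ℂ := by
  have : Fact (channelKernel T).PosSemidef := ⟨posSemidef_channelKernel hT.1⟩
  have hk : ∀ x y z, RKHS.kerFun (RKHS.OfKernel (channelKernel T)) x y z =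
      (T (ketBra z x) : G →L[ℂ] G) y := fun x y z => by
    rw [RKHS.kerFun_apply, RKHS.OfKernel.kernel_ofKernel]
    rfl
  have hi : ∀ x x' y y', ⟪RKHS.kerFun (RKHS.OfKernel (channelKernel T)) x y,
      RKHS.kerFun (RKHS.OfKernel (channelKernel T)) x' y'⟫_ℂ =
      ⟪y, (T (ketBra x x') : G →L[ℂ] G) y'⟫_ℂ := fun x x' y y' => by
    rw [RKHS.kerFun_inner, hk]
  let Ψ : H →ₗ⋆[ℂ] G →L[ℂ] RKHS.OfKernel (channelKernel T) :=
    { toFun := fun x => RKHS.kerFun (RKHS.OfKernel (channelKernel T)) x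
      map_add' := fun x x' => by
        refine ContinuousLinearMap.ext fun y => RKHS.ext fun z => ?_
        have : ketBra z (x + x') = ketBra z x + ketBra z x' :=
          Subtype.ext (ContinuousLinearMap.ext fun w => by simp [coe_ketBra])
        rw [add_apply, RKHS.coe_add, Pi.add_apply, hk, hk, hk, this, map_add, Submodule.coe_add,
          add_apply]
      map_smul' := fun a x => by
        refine ContinuousLinearMap.ext fun y => RKHS.ext fun z => ?_
        have : ketBra z (a • x) = (starRingEnd ℂ) a • ketBra z x :=
          Subtype.ext (ContinuousLinearMap.ext fun w => by simp [coe_ketBra])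
        rw [smul_apply, RKHS.coe_smul, Pi.smul_apply, hk, hk, this, map_smul, Submodule.coe_smul,
          smul_apply] }
  refine ⟨_, inferInstance, inferInstance, inferInstance, Ψ.mkContinuous 1 fun x => ?_, hi⟩
  refine opNorm_le_bound _ (by positivity) fun y => ?_
  have hp : (ketBra x x : H →L[ℂ] H).IsPositive := isPositive_rankOne_self x
  have h1 := quadForm_le_trace (hT.1.isPositive hp) (T (ketBra x x)).2 y
  have h2 : ENNReal.ofReal (‖Ψ x y‖ ^ 2) ≤ ENNReal.ofReal ((‖x‖ * ‖y‖) ^ 2) := by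
    rw [hT.2, coe_ketBra, trace_rankOne_self, quadForm, ← hi, inner_self_eq_norm_sq_to_K,
      Complex.ofReal_re, ← ofReal_norm, ← ENNReal.ofReal_pow (norm_nonneg _),
      ← ENNReal.ofReal_mul (by positivity), ← mul_pow] at h1
    convert h1 using 2
    norm_cast
  rw [ENNReal.ofReal_le_ofReal_iff (by positivity)] at h2
  rw [one_mul]
  exact (sq_le_sq₀ (norm_nonneg _) (by positivity)).1 h2

/-- The coordinate along `f` of a Stinespring map `Ψ`: the operator `M` with
`⟨M x, y⟩ = ⟨f, Ψ x y⟩`. -/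
def stinespringCoord {E : Type*} [NormedAddCommGroup E] [InnerProductSpace ℂ E] [CompleteSpace E]
    (Ψ : H →L⋆[ℂ] G →L[ℂ] E) (f : E) : H →L[ℂ] G :=
  LinearMap.mkContinuous
    { toFun := fun x => adjoint (Ψ x) f
      map_add' := fun x x' => by rw [map_add, map_add, add_apply]
      map_smul' := fun a x => by
        rw [map_smulₛₗ, map_smulₛₗ, Complex.conj_conj, smul_apply, RingHom.id_apply] }
    (‖Ψ‖ * ‖f‖) fun x => by
      refine ((adjoint (Ψ x)).le_opNorm f).trans ?_
      rw [LinearIsometryEquiv.norm_map, mul_right_comm]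
      gcongr
      exact Ψ.le_opNorm x

theorem inner_stinespringCoord {E : Type*} [NormedAddCommGroup E] [InnerProductSpace ℂ E]
    [CompleteSpace E] (Ψ : H →L⋆[ℂ] G →L[ℂ] E) (f : E) (x : H) (y : G) :
    ⟪stinespringCoord Ψ f x, y⟫_ℂ = ⟪f, Ψ x y⟫_ℂ := by
  have h : stinespringCoord Ψ f x = adjoint (Ψ x) f := rfl
  rw [h, adjoint_inner_left]

theorem eq_zero_of_basis {ι κ : Type*} (b : HilbertBasis ι ℂ H) (c : HilbertBasis κ ℂ G)
    {A : H →L[ℂ] G} (h : ∀ i j, ⟪A (b i), c j⟫_ℂ = 0) : A = 0 := by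
  have h1 : ∀ y, adjoint A y = 0 := fun y => basis_ext b fun i => by
    have h2 : A (b i) = 0 := basis_ext c fun j => by rw [← inner_conj_symm, h, map_zero]
    rw [adjoint_inner_right, h2, inner_zero_left]
  refine ContinuousLinearMap.ext fun x => ext_inner_right ℂ fun y => ?_
  rw [← adjoint_inner_right, h1, inner_zero_right, zero_apply, inner_zero_left]

/-- Every channel between separable spaces has a countable Kraus family: the coordinates of the
Stinespring map in an orthonormal basis.  All but countably many of them vanish, since each of the
countably many matrix entries of the Stinespring map has countably many nonzero coordinates. -/
theorem IsSchrodingerChannel.exists_isKrausFamily [TopologicalSpace.SeparableSpace H]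
    [TopologicalSpace.SeparableSpace G] {T : traceClass H →ₗ[ℂ] traceClass G}
    (hT : IsSchrodingerChannel T) : ∃ M : ℕ → H →L[ℂ] G, IsKrausFamily M T := by
  obtain ⟨E, _, _, _, Ψ, hΨ⟩ := hT.exists_stinespring
  obtain ⟨w, f, -⟩ := exists_hilbertBasis ℂ E
  have : Countable (stdIndex H) := countable_hilbertBasis (stdBasis H)
  have : Countable (stdIndex G) := countable_hilbertBasis (stdBasis G)
  have hcount : {k | stinespringCoord Ψ (f k) ≠ 0}.Countable := by
    have h1 : ∀ (i : stdIndex H) (j : stdIndex G),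
        {k | ⟪f k, Ψ (stdBasis H i) (stdBasis G j)⟫_ℂ ≠ 0}.Countable := fun i j => by
      refine (f.summable_inner_mul_inner (Ψ (stdBasis H i) (stdBasis G j))
        (Ψ (stdBasis H i) (stdBasis G j))).countable_support.mono fun k hk => ?_
      refine mul_ne_zero (fun h => hk ?_) hk
      rw [← inner_conj_symm, h, map_zero]
    refine (Set.countable_iUnion fun i => Set.countable_iUnion fun j => h1 i j).mono fun k hk => ?_
    by_contra hn
    simp only [Set.mem_iUnion, Set.mem_ofPred_eq, not_exists, not_not] at hn
    exact hk (eq_zero_of_basis (stdBasis H) (stdBasis G) fun i j => by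
      rw [inner_stinespringCoord, hn])
  have : Countable {k | stinespringCoord Ψ (f k) ≠ 0} := hcount.to_subtype
  obtain ⟨e, he⟩ := exists_injective_nat {k | stinespringCoord Ψ (f k) ≠ 0}
  -- The nonzero coordinates, reindexed by naturals and padded with zeros.
  refine ⟨Function.extend e (fun k => stinespringCoord Ψ (f k)) 0,
    hT.isKrausFamily _ fun x y => ?_⟩
  have h1 : quadForm (T (ketBra x x) : G →L[ℂ] G) y = ‖Ψ x y‖ₑ ^ 2 := by
    rw [quadForm, ← hΨ, inner_self_eq_norm_sq_to_K, ← ofReal_norm,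
      ← ENNReal.ofReal_pow (norm_nonneg _)]
    norm_cast
  have h2 : ∀ n, ‖⟪Function.extend e (fun k => stinespringCoord Ψ (f k)) 0 n x, y⟫_ℂ‖ₑ ^ 2 =
      Function.extend e (fun k => ‖⟪stinespringCoord Ψ (f k) x, y⟫_ℂ‖ₑ ^ 2) 0 n := fun n => by
    by_cases hn : ∃ k, e k = n
    · obtain ⟨k, rfl⟩ := hn
      rw [he.extend_apply, he.extend_apply]
    · rw [Function.extend_apply' _ _ _ hn, Function.extend_apply' _ _ _ hn]
      simp
  rw [h1, parseval f, tsum_congr h2, tsum_extend_zero he,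
    tsum_subtype {k | stinespringCoord Ψ (f k) ≠ 0}
      fun k => ‖⟪stinespringCoord Ψ (f k) x, y⟫_ℂ‖ₑ ^ 2]
  refine tsum_congr fun k => ?_
  rw [← inner_stinespringCoord]
  by_cases hk : stinespringCoord Ψ (f k) = 0
  · simp [hk]
  · rw [Set.indicator_of_mem (by exact hk)]

end Kraus

/-! ### Slices of the Hilbert space tensor product -/

section Slices

variable {H K X : Type*}
  [NormedAddCommGroup H] [InnerProductSpace ℂ H] [CompleteSpace H]
  [NormedAddCommGroup K] [InnerProductSpace ℂ K] [CompleteSpace K]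
  [NormedAddCommGroup X] [InnerProductSpace ℂ X] [CompleteSpace X]

/-- The operator `x ↦ x ⊗ y` from `H` to `H ⊗ K`.  Its adjoint `id ⊗ ⟨y|` extracts the `H`-valued
coordinate along `y`. -/
def slot (H : Type*) {K : Type*} [NormedAddCommGroup H] [InnerProductSpace ℂ H]
    [NormedAddCommGroup K] [InnerProductSpace ℂ K] (y : K) : H →L[ℂ] HTensor H K :=
  LinearMap.mkContinuous
    { toFun := fun x => htmul x y
      map_add' := fun x x' => by
        simp only [htmul, TensorProduct.add_tmul, UniformSpace.Completion.coe_add]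
      map_smul' := fun a x => by
        rw [htmul, ← TensorProduct.smul_tmul', UniformSpace.Completion.coe_smul]
        rfl } ‖y‖ fun x => by
    simp [htmul, mul_comm]

theorem slot_apply (x : H) (y : K) : slot H y x = htmul x y := rfl

theorem adjoint_slot_htmul (x : H) (y y' : K) :
    adjoint (slot H y) (htmul x y') = ⟪y, y'⟫_ℂ • x := by
  refine ext_inner_left ℂ fun v => ?_
  rw [adjoint_inner_right, slot_apply, inner_htmul, inner_smul_right, mul_comm]

variable {ι : Type*} (c : HilbertBasis ι ℂ K)

theorem parseval_slot (z : HTensor H K) : ‖z‖ₑ ^ 2 = ∑' j, ‖adjoint (slot H (c j)) z‖ₑ ^ 2 := by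
  obtain ⟨d, hd⟩ := exists_tensorBasis (stdBasis H) c
  rw [parseval d, ENNReal.tsum_prod', ENNReal.tsum_comm]
  refine tsum_congr fun j => ?_
  rw [parseval (stdBasis H)]
  refine tsum_congr fun i => ?_
  rw [hd, adjoint_inner_right, slot_apply]

theorem eq_of_adjoint_slot_eq {z z' : HTensor H K}
    (h : ∀ j, adjoint (slot H (c j)) z = adjoint (slot H (c j)) z') : z = z' := by
  have h1 := parseval_slot c (z - z')
  simp only [map_sub, h, sub_self, enorm_zero] at h1
  rw [← sub_eq_zero]
  simpa using h1

theorem orthogonalFamily_slot : OrthogonalFamily ℂ (fun _ : ι => H) fun j =>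
    (⟨(slot H (c j)).toLinearMap, fun x => by
      simp [slot_apply, htmul, c.orthonormal.1 j]⟩ : H →ₗᵢ[ℂ] HTensor H K) := by
  intro i j hij x x'
  change ⟪slot H (c i) x, slot H (c j) x'⟫_ℂ = 0
  rw [slot_apply, slot_apply, inner_htmul, c.orthonormal.2 hij, mul_zero]

/-- Operators `B_j` with `∑ ‖B_j x‖² = ‖x‖²` are the coordinates of an isometry into `H ⊗ K`. -/
theorem exists_isometry_of_coords (B : ι → X →L[ℂ] H)
    (hB : ∀ x, ∑' j, ‖B j x‖ₑ ^ 2 = ‖x‖ₑ ^ 2) :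
    ∃ S : X →L[ℂ] HTensor H K, adjoint S ∘L S = ContinuousLinearMap.id ℂ X ∧
      ∀ j x, adjoint (slot H (c j)) (S x) = B j x := by
  have hs : ∀ x, Summable fun j => slot H (c j) (B j x) := fun x => by
    have h1 : Summable fun j => ‖B j x‖ ^ 2 := by
      have : ∑' j, ‖B j x‖ₑ ^ 2 ≠ ⊤ := by
        rw [hB]
        simp
      simpa using ENNReal.summable_toReal this
    exact ((orthogonalFamily_slot (H := H) c).summable_iff_norm_sq_summable _).2 h1
  have hc : ∀ j x, adjoint (slot H (c j)) (∑' k, slot H (c k) (B k x)) = B j x := fun j x => by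
    have h1 := (adjoint (slot H (c j))).hasSum (hs x).hasSum
    refine h1.unique ?_
    convert hasSum_single j fun k hk => ?_ using 1
    · rw [slot_apply, adjoint_slot_htmul, inner_self_eq_norm_sq_to_K, c.orthonormal.1]
      simp
    · rw [slot_apply, adjoint_slot_htmul, c.orthonormal.2 hk.symm, zero_smul]
  have hn : ∀ x, ‖∑' k, slot H (c k) (B k x)‖ = ‖x‖ := fun x => by
    have h1 := parseval_slot c (∑' k, slot H (c k) (B k x))
    simp_rw [hc, hB] at h1
    rw [← ofReal_norm, ← ofReal_norm, ← ENNReal.ofReal_pow (norm_nonneg _),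
      ← ENNReal.ofReal_pow (norm_nonneg _),
      ENNReal.ofReal_eq_ofReal_iff (by positivity) (by positivity)] at h1
    exact (sq_eq_sq₀ (norm_nonneg _) (norm_nonneg _)).1 h1
  let S : X →L[ℂ] HTensor H K := LinearMap.mkContinuous
    { toFun := fun x => ∑' k, slot H (c k) (B k x)
      map_add' := fun x x' => by
        simp only [map_add]
        exact (hs x).tsum_add (hs x')
      map_smul' := fun a x => by
        simp only [map_smul]
        exact (hs x).tsum_const_smul a } 1 fun x => by
      rw [one_mul]
      exact (hn x).le
  exact ⟨S, S.norm_map_iff_adjoint_comp_self.1 hn, hc⟩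

end Slices

/-! ### The partial trace -/

section PartialTrace

variable {H K : Type*}
  [NormedAddCommGroup H] [InnerProductSpace ℂ H] [CompleteSpace H]
  [NormedAddCommGroup K] [InnerProductSpace ℂ K] [CompleteSpace K]
  {ι : Type*} (c : HilbertBasis ι ℂ K)

/-- With `Z = X† Y`, the norm of the `j`-th slice is at most that of `X (id ⊗ |c_j⟩)` times that of
`Y (id ⊗ |c_j⟩)`, and both are square summable since they are dominated by Hilbert-Schmidt sums. -/
theorem summable_slice {Z : HTensor H K →L[ℂ] HTensor H K} (hZ : IsTraceClass Z) :
    Summable fun j => adjoint (slot H (c j)) ∘L Z ∘L slot H (c j) := by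
  obtain ⟨X, Y, rfl, hs⟩ := hZ.exists_factor
  obtain ⟨d, hd⟩ := exists_tensorBasis (stdBasis H) c
  have key : ∀ R : HTensor H K →L[ℂ] HTensor H K, hsSum (stdBasis _) R ≠ ⊤ →
      Summable fun j => ‖R ∘L slot H (c j)‖ ^ 2 := by
    intro R hR
    have h1 : ∑' j, hsSum (stdBasis H) (R ∘L slot H (c j)) ≠ ⊤ := by
      rw [hsSum_basis _ d, hsSum, ENNReal.tsum_prod', ENNReal.tsum_comm] at hR
      simp only [hd] at hR
      exact hR
    have h2 : ∀ j, hsSum (stdBasis H) (R ∘L slot H (c j)) ≠ ⊤ := ENNReal.ne_top_of_tsum_ne_top h1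
    refine Summable.of_nonneg_of_le (fun j => by positivity) (fun j => ?_)
      (ENNReal.summable_toReal h1)
    have h3 : ‖R ∘L slot H (c j)‖ ≤ √(hsSum (stdBasis H) (R ∘L slot H (c j))).toReal := by
      refine opNorm_le_bound _ (Real.sqrt_nonneg _) fun x => ?_
      refine (sq_le_sq₀ (norm_nonneg _) (by positivity)).1 ?_
      rw [mul_pow, Real.sq_sqrt ENNReal.toReal_nonneg]
      have h4 := ENNReal.toReal_mono (ENNReal.mul_ne_top (h2 j) (by simp))
        (enorm_apply_sq_le_hsSum (stdBasis H) (R ∘L slot H (c j)) x)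
      simpa using h4
    calc _ ≤ √(hsSum (stdBasis H) (R ∘L slot H (c j))).toReal ^ 2 := by gcongr
      _ = _ := Real.sq_sqrt ENNReal.toReal_nonneg
  refine Summable.of_norm_bounded ((key X (hs _).1).add (key Y (hs _).2)) fun j => ?_
  have h5 : adjoint (slot H (c j)) ∘L (adjoint X ∘L Y) ∘L slot H (c j) =
      adjoint (X ∘L slot H (c j)) ∘L (Y ∘L slot H (c j)) := by
    rw [adjoint_comp]
    rfl
  rw [h5]
  refine (opNorm_comp_le _ _).trans ?_
  rw [LinearIsometryEquiv.norm_map]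
  nlinarith [sq_nonneg (‖X ∘L slot H (c j)‖ - ‖Y ∘L slot H (c j)‖),
    sq_nonneg ‖X ∘L slot H (c j)‖, sq_nonneg ‖Y ∘L slot H (c j)‖]

/-- The operator `∑ (id ⊗ ⟨c_j|) Z (id ⊗ |c_j⟩)`, a sum converging in operator norm for trace-class
`Z`. -/
def sliceSum (Z : HTensor H K →L[ℂ] HTensor H K) : H →L[ℂ] H :=
  ∑' j, adjoint (slot H (c j)) ∘L Z ∘L slot H (c j)

theorem hasSum_inner_sliceSum {Z : HTensor H K →L[ℂ] HTensor H K} (hZ : IsTraceClass Z)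
    (y y' : H) :
    HasSum (fun j => ⟪slot H (c j) y, Z (slot H (c j) y')⟫_ℂ) ⟪y, sliceSum c Z y'⟫_ℂ := by
  have h1 := (innerSL ℂ y ∘L ContinuousLinearMap.apply ℂ H y').hasSum (summable_slice c hZ).hasSum
  have h2 : ∀ A : H →L[ℂ] H,
      (innerSL ℂ y ∘L ContinuousLinearMap.apply ℂ H y') A = ⟪y, A y'⟫_ℂ := fun _ => rfl
  simp only [h2, comp_apply, adjoint_inner_right] at h1
  exact h1

theorem hasSum_trace_sliceSum {κ : Type*} (b : HilbertBasis κ ℂ H)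
    {Z : HTensor H K →L[ℂ] HTensor H K} (hZ : IsTraceClass Z) (W : H →L[ℂ] H) :
    HasSum (fun i => ⟪b i, W (sliceSum c Z (b i))⟫_ℂ)
      (trace (opTensor W (ContinuousLinearMap.id ℂ K) ∘L Z)) := by
  obtain ⟨d, hd⟩ := exists_tensorBasis b c
  have h1 : IsTraceClass (opTensor W (ContinuousLinearMap.id ℂ K) ∘L Z) :=
    hZ.comp _ (ContinuousLinearMap.id ℂ _)
  refine (h1.hasSum_trace d).prod_fiberwise fun i => ?_
  rw [← adjoint_inner_left]
  convert hasSum_inner_sliceSum c hZ (adjoint W (b i)) (b i) using 2 with j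
  rw [hd, comp_apply, ← adjoint_inner_left, adjoint_opTensor, opTensor_htmul, slot_apply,
    slot_apply, ContinuousLinearMap.adjoint_id, id_apply]

/-- The partial trace over `K`, computed in the basis `c`. -/
def partialTrace : traceClass (HTensor H K) →ₗ[ℂ] traceClass H where
  toFun Z := ⟨sliceSum c (Z : HTensor H K →L[ℂ] HTensor H K),
    isTraceClass_of_summable (stdBasis H) fun W =>
      (hasSum_trace_sliceSum c (stdBasis H) Z.2 W).summable⟩
  map_add' Z Z' := Subtype.ext <| by
    change sliceSum c _ = sliceSum c _ + sliceSum c _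
    rw [sliceSum, sliceSum, sliceSum, ← (summable_slice c Z.2).tsum_add (summable_slice c Z'.2)]
    simp
  map_smul' a Z := Subtype.ext <| by
    change sliceSum c _ = a • sliceSum c _
    rw [sliceSum, sliceSum, ← (summable_slice c Z.2).tsum_const_smul a]
    simp

theorem isPartialTrace_partialTrace : IsPartialTrace (partialTrace (H := H) c) := fun B A =>
  (hasSum_trace_sliceSum c (stdBasis H) A.2 B).tsum_eq

theorem isKrausFamily_partialTrace :
    IsKrausFamily (fun j => adjoint (slot H (c j))) (partialTrace (H := H) c) := by
  intro Z hZ y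
  have h := Complex.hasSum_re (hasSum_inner_sliceSum c Z.2 y y)
  simp_rw [adjoint_adjoint]
  change ENNReal.ofReal (⟪y, sliceSum c (Z : HTensor H K →L[ℂ] HTensor H K) y⟫_ℂ).re = _
  rw [← h.tsum_eq, ENNReal.ofReal_tsum_of_nonneg _ h.summable]
  · rfl
  · intro j
    exact (Complex.nonneg_iff.1 ((isPositive_iff_inner_nonneg _).1 hZ _)).1

theorem isCompletelyPositive_partialTrace :
    IsCompletelyPositive (partialTrace (H := H) c) := by
  intro n A hA y
  have h : HasSum (fun j => ∑ i, ∑ k, ⟪slot H (c j) (y i),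
      (A i k : HTensor H K →L[ℂ] HTensor H K) (slot H (c j) (y k))⟫_ℂ)
      (∑ i, ∑ k, ⟪y i, (partialTrace c (A i k) : H →L[ℂ] H) (y k)⟫_ℂ) :=
    hasSum_sum fun i _ => hasSum_sum fun k _ => hasSum_inner_sliceSum c (A i k).2 _ _
  exact h.nonneg fun j => hA fun i => slot H (c j) (y i)

theorem IsPartialTrace.map_leftMul {E : traceClass (HTensor H K) →ₗ[ℂ] traceClass H}
    (hE : IsPartialTrace E) (B : H →L[ℂ] H) (A : traceClass (HTensor H K)) :
    E (leftMul (opTensor B (ContinuousLinearMap.id ℂ K)) A) = leftMul B (E A) := by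
  refine Subtype.ext (ContinuousLinearMap.ext fun y => ext_inner_left ℂ fun x => ?_)
  rw [← trace_rankOne_comp, ← trace_rankOne_comp, hE]
  change _ = trace (rankOne ℂ y x ∘L B ∘L (E A : H →L[ℂ] H))
  rw [← comp_assoc, hE]
  change trace (_ ∘L _ ∘L _) = _
  rw [← comp_assoc, ← opTensor_comp, comp_id]

/-- The ampliation `B ↦ B ⊗ id`, the dual of the partial trace. -/
def ampliation (H K : Type*) [NormedAddCommGroup H] [InnerProductSpace ℂ H] [CompleteSpace H]
    [NormedAddCommGroup K] [InnerProductSpace ℂ K] [CompleteSpace K] :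
    (H →L[ℂ] H) →ₗ[ℂ] (HTensor H K →L[ℂ] HTensor H K) where
  toFun B := opTensor B (ContinuousLinearMap.id ℂ K)
  map_add' B B' := opTensor_ext fun x y => by simp [opTensor_htmul, htmul_add_left]
  map_smul' a B := opTensor_ext fun x y => by simp [opTensor_htmul, htmul_smul_left]

end PartialTrace

/-! ### Adjoining a pure ancilla state -/

section Ancilla

variable {H K : Type*}
  [NormedAddCommGroup H] [InnerProductSpace ℂ H] [CompleteSpace H]
  [NormedAddCommGroup K] [InnerProductSpace ℂ K] [CompleteSpace K]

theorem isPureState_ketBra {e : K} (he : ‖e‖ = 1) : IsPureState (ketBra e e) := by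
  refine ⟨⟨isPositive_rankOne_self e, ?_⟩, ?_⟩
  · rw [coe_ketBra, trace_rankOne_self, he]
    simp
  · have h0 : e ≠ 0 := fun h => by simp [h] at he
    exact rank_rankOne h0 h0

theorem coe_tensorRight_ketBra (e : K) (A : traceClass H) :
    (tensorRight (ketBra e e) A : HTensor H K →L[ℂ] HTensor H K) =
      slot H e ∘L (A : H →L[ℂ] H) ∘L adjoint (slot H e) := by
  refine opTensor_ext fun x y => ?_
  change opTensor (A : H →L[ℂ] H) (rankOne ℂ e e) (htmul x y) = _
  rw [opTensor_htmul, comp_apply, comp_apply, adjoint_slot_htmul, map_smul, map_smul, slot_apply,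
    rankOne_apply, htmul, htmul, TensorProduct.tmul_smul, UniformSpace.Completion.coe_smul]

theorem adjoint_slot_comp_slot {e : K} (he : ‖e‖ = 1) :
    adjoint (slot H e) ∘L slot H e = ContinuousLinearMap.id ℂ H := by
  ext x
  rw [comp_apply, slot_apply, adjoint_slot_htmul, inner_self_eq_norm_sq_to_K, he]
  simp

theorem isCompletelyPositive_tensorRight_ketBra (e : K) :
    IsCompletelyPositive (tensorRight (H := H) (ketBra e e)) := by
  intro n A hA y
  convert hA fun i => adjoint (slot H e) (y i) using 4 with i _ j _
  rw [coe_tensorRight_ketBra, comp_apply, comp_apply, ← adjoint_inner_left]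

theorem partialTrace_tensorRight {ι : Type*} (c : HilbertBasis ι ℂ K) (o : ι)
    (A : traceClass H) : partialTrace c (tensorRight (ketBra (c o) (c o)) A) = A := by
  refine Subtype.ext (ContinuousLinearMap.ext fun y' => ext_inner_left ℂ fun y => ?_)
  refine (hasSum_inner_sliceSum c (tensorRight (ketBra (c o) (c o)) A).2 y y').unique ?_
  rw [coe_tensorRight_ketBra]
  convert hasSum_single o fun j hj => ?_ using 1
  · simp [slot_apply, adjoint_slot_htmul, inner_htmul, inner_self_eq_norm_sq_to_K,
      c.orthonormal.1 o]
  · simp [slot_apply, inner_htmul, c.orthonormal.2 hj]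

theorem IsTraceClass.abs {A : H →L[ℂ] H} (hA : IsTraceClass A) : IsTraceClass (CFC.abs A) := by
  obtain ⟨w, b, h⟩ := hA
  exact ⟨w, b, by rwa [CFC.cfcAbs_cfcAbs]⟩

/-- The right-hand side is a positive square root of `(S A S†)† (S A S†) = S A† A S†`. -/
theorem abs_conj_isometry {G : Type*} [NormedAddCommGroup G] [InnerProductSpace ℂ G]
    [CompleteSpace G] (S : H →L[ℂ] G) (hS : adjoint S ∘L S = ContinuousLinearMap.id ℂ H)
    (A : H →L[ℂ] H) : CFC.abs (S ∘L A ∘L adjoint S) = S ∘L CFC.abs A ∘L adjoint S := by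
  have hmul : ∀ B C : H →L[ℂ] H,
      (S ∘L B ∘L adjoint S) * (S ∘L C ∘L adjoint S) = S ∘L (B * C) ∘L adjoint S := fun B C => by
    ext x
    have h := fun z => DFunLike.congr_fun hS z
    simp only [comp_apply, id_apply] at h
    simp [mul_apply_eq_comp, h]
  refine CFC.sqrt_unique ?_ ?_
  · rw [hmul, CFC.abs_mul_abs, star_eq_adjoint, star_eq_adjoint, adjoint_comp, adjoint_comp,
      adjoint_adjoint, comp_assoc, hmul]
  · rw [nonneg_iff_isPositive]
    exact ((nonneg_iff_isPositive _).1 (CFC.abs_nonneg A)).conj_adjoint S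

theorem traceNorm_tensorRight_ketBra {ι : Type*} (c : HilbertBasis ι ℂ K) (o : ι)
    (A : traceClass H) : traceNorm (tensorRight (ketBra (c o) (c o)) A) = traceNorm A := by
  have h1 := isPartialTrace_partialTrace c (ContinuousLinearMap.id ℂ H)
    (tensorRight (ketBra (c o) (c o)) ⟨_, IsTraceClass.abs A.2⟩)
  have h2 : opTensor (ContinuousLinearMap.id ℂ H) (ContinuousLinearMap.id ℂ K) =
      ContinuousLinearMap.id ℂ (HTensor H K) := opTensor_ext fun x y => by simp [opTensor_htmul]
  rw [partialTrace_tensorRight, h2, id_comp, id_comp, coe_tensorRight_ketBra,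
    ← abs_conj_isometry _ (adjoint_slot_comp_slot (c.orthonormal.1 o)),
    ← coe_tensorRight_ketBra] at h1
  rw [traceNorm, traceNorm, h1]

theorem traceNorm_ketBra_self (x : H) : traceNorm (ketBra x x) = ‖x‖ ^ 2 := by
  have h : 0 ≤ (rankOne ℂ x x : H →L[ℂ] H) :=
    (nonneg_iff_isPositive _).2 (isPositive_rankOne_self x)
  rw [traceNorm, coe_ketBra, CFC.abs_of_nonneg _ h, trace_rankOne_self, Complex.ofReal_re]

theorem isLeast_norm_tensorRight [Nontrivial H] {ι : Type*} (c : HilbertBasis ι ℂ K) (o : ι) :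
    IsLeast {a : ℝ | 0 ≤ a ∧ ∀ A : traceClass H,
      traceNorm (tensorRight (ketBra (c o) (c o)) A) ≤ a * traceNorm A} 1 := by
  refine ⟨⟨zero_le_one, fun A => ?_⟩, fun a ha => ?_⟩
  · rw [traceNorm_tensorRight_ketBra, one_mul]
  · obtain ⟨x, hx⟩ := exists_ne (0 : H)
    have h := ha.2 (ketBra x x)
    rw [traceNorm_tensorRight_ketBra, traceNorm_ketBra_self] at h
    have hp : 0 < ‖x‖ ^ 2 := by positivity
    exact le_of_mul_le_mul_right (by rwa [one_mul]) hp

end Ancilla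

/-! ### The unitary -/

/-- Halmos dilation inside one algebra: if `s₀, s₁` are isometries with complementary ranges, an
isometry `w` becomes, after conjugation with `s₀`, the corner of a unitary with invariant subspace
the range of `s₀`. -/
theorem exists_unitary_mul_eq {A : Type*} [Ring A] [StarRing A] {w s₀ s₁ : A}
    (hw : star w * w = 1) (h₀ : star s₀ * s₀ = 1) (h₁ : star s₁ * s₁ = 1)
    (h₀₁ : star s₀ * s₁ = 0) (h : s₀ * star s₀ + s₁ * star s₁ = 1) :
    ∃ v : unitary A, (v : A) * s₀ = s₀ * w := by
  have h₁₀ : star s₁ * s₀ = 0 := by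
    have := congrArg star h₀₁
    simpa using this
  have aw : ∀ x, star w * (w * x) = x := fun x => by rw [← mul_assoc, hw, one_mul]
  have a₀ : ∀ x, star s₀ * (s₀ * x) = x := fun x => by rw [← mul_assoc, h₀, one_mul]
  have a₁ : ∀ x, star s₁ * (s₁ * x) = x := fun x => by rw [← mul_assoc, h₁, one_mul]
  have a₀₁ : ∀ x, star s₀ * (s₁ * x) = 0 := fun x => by rw [← mul_assoc, h₀₁, zero_mul]
  have a₁₀ : ∀ x, star s₁ * (s₀ * x) = 0 := fun x => by rw [← mul_assoc, h₁₀, zero_mul]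
  refine ⟨⟨s₀ * (w * star s₀) + s₀ * ((1 - w * star w) * star s₁) + s₁ * (star w * star s₁),
    Unitary.mem_iff.2 ⟨?_, ?_⟩⟩, ?_⟩
  · refine Eq.trans ?_ h
    simp only [star_add, star_mul, star_sub, star_star, mul_add, add_mul, mul_assoc, a₀,
      a₁, a₀₁, a₁₀, aw, sub_mul, mul_sub, one_mul, mul_zero]
    abel
  · refine Eq.trans ?_ h
    simp only [star_add, star_mul, star_sub, star_star, mul_add, add_mul, mul_assoc, a₀,
      a₁, a₀₁, a₁₀, aw, sub_mul, mul_sub, one_mul, mul_zero]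
    abel
  · simp only [add_mul, mul_assoc, h₀, h₁₀, mul_zero, mul_one, add_zero]

section Dilation

variable {H K : Type*}
  [NormedAddCommGroup H] [InnerProductSpace ℂ H] [CompleteSpace H]
  [NormedAddCommGroup K] [InnerProductSpace ℂ K] [CompleteSpace K]
  (c : HilbertBasis ℕ ℂ K)

theorem adjoint_slot_basis {ι : Type*} [DecidableEq ι] (c : HilbertBasis ι ℂ K) (i j : ι) (x : H) :
    adjoint (slot H (c i)) (slot H (c j) x) = if i = j then x else 0 := by
  rw [slot_apply, adjoint_slot_htmul, orthonormal_iff_ite.1 c.orthonormal]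
  split_ifs <;> simp

/-- The isometry of `H ⊗ K` that sends `x ⊗ c_u` to `x ⊗ c_{2u+r}`. -/
theorem exists_isometry_spread {r : ℕ} (hr : r < 2) :
    ∃ S : HTensor H K →L[ℂ] HTensor H K, adjoint S ∘L S = ContinuousLinearMap.id ℂ _ ∧
      (∀ u x, S (slot H (c u) x) = slot H (c (2 * u + r)) x) ∧
      ∀ j z, adjoint (slot H (c j)) (S z) =
        if j % 2 = r then adjoint (slot H (c (j / 2))) z else 0 := by
  have hinj : Function.Injective fun u : ℕ => 2 * u + r := fun u v h => by
    simp only at h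
    omega
  obtain ⟨S, hS, hc⟩ := exists_isometry_of_coords c
    (fun j => if j % 2 = r then adjoint (slot H (c (j / 2))) else 0) fun z => by
      rw [← hinj.tsum_eq, parseval_slot c z]
      · refine tsum_congr fun u => ?_
        have h1 : (2 * u + r) % 2 = r := by omega
        have h2 : (2 * u + r) / 2 = u := by omega
        simp only [h1, h2, if_true]
      · intro j hj
        by_cases h : j % 2 = r
        · exact ⟨j / 2, by simp only; omega⟩
        · simp [h] at hj
  have hc' : ∀ j z, adjoint (slot H (c j)) (S z) =
      if j % 2 = r then adjoint (slot H (c (j / 2))) z else 0 := fun j z => by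
    rw [hc]
    split_ifs <;> rfl
  refine ⟨S, hS, fun u x => eq_of_adjoint_slot_eq c fun j => ?_, hc'⟩
  rw [hc', adjoint_slot_basis, adjoint_slot_basis]
  split_ifs with h1 h2 h3 h3 h3 <;> first | rfl | omega

theorem adjoint_slot_adjoint_spread {r : ℕ} {S : HTensor H K →L[ℂ] HTensor H K}
    (hS : ∀ u x, S (slot H (c u) x) = slot H (c (2 * u + r)) x) (u : ℕ) (z : HTensor H K) :
    adjoint (slot H (c u)) (adjoint S z) = adjoint (slot H (c (2 * u + r))) z := by
  refine ext_inner_left ℂ fun x => ?_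
  rw [adjoint_inner_right, adjoint_inner_right, hS, adjoint_inner_right]

theorem injective_pair_succ : Function.Injective fun p : ℕ × ℕ => Nat.pair p.1 p.2 + 1 :=
  fun p q h => by
    have h1 := Nat.succ_injective h
    exact Prod.ext (Nat.pair_eq_pair.1 h1).1 (Nat.pair_eq_pair.1 h1).2

/-- Sums over nonzero naturals as double sums, through the pairing function. -/
theorem tsum_eq_tsum_pair {f : ℕ → ℝ≥0∞} (h : f 0 = 0) :
    ∑' j, f j = ∑' k, ∑' u, f (Nat.pair k u + 1) := by
  rw [← ENNReal.tsum_prod (f := fun k u => f (Nat.pair k u + 1)),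
    ← injective_pair_succ.tsum_eq]
  intro j hj
  cases j with
  | zero => exact absurd h hj
  | succ j => exact ⟨Nat.unpair j, by simp⟩

/-- The isometry `W (x ⊗ c_u) = ∑ M_k x ⊗ c_{⟨k, u⟩ + 1}`, which applies one step of the channel
and records the outcome `k` in the history `u`. -/
theorem exists_isometry_step (M : ℕ → H →L[ℂ] H) (hM : ∀ x, ∑' k, ‖M k x‖ₑ ^ 2 = ‖x‖ₑ ^ 2) :
    ∃ W : HTensor H K →L[ℂ] HTensor H K, adjoint W ∘L W = ContinuousLinearMap.id ℂ _ ∧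
      (∀ z, adjoint (slot H (c 0)) (W z) = 0) ∧
      ∀ k u z, adjoint (slot H (c (Nat.pair k u + 1))) (W z) =
        M k (adjoint (slot H (c u)) z) := by
  let B : ℕ → HTensor H K →L[ℂ] H := fun j => Nat.casesOn j 0 fun j =>
    M (Nat.unpair j).1 ∘L adjoint (slot H (c (Nat.unpair j).2))
  have hB : ∀ k u z, B (Nat.pair k u + 1) z = M k (adjoint (slot H (c u)) z) := fun k u z => by
    simp [B]
  obtain ⟨W, hW, hc⟩ := exists_isometry_of_coords c B fun z => by
    rw [tsum_eq_tsum_pair (by simp [B]), ENNReal.tsum_comm]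
    simp_rw [hB, hM]
    exact (parseval_slot c z).symm
  exact ⟨W, hW, fun z => hc 0 z, fun k u z => by rw [hc, hB]⟩

theorem quadForm_conj {G : Type*} [NormedAddCommGroup G] [InnerProductSpace ℂ G] [CompleteSpace G]
    (S : H →L[ℂ] G) (A : H →L[ℂ] H) (y : G) :
    quadForm (S ∘L A ∘L adjoint S) y = quadForm A (adjoint S y) := by
  rw [quadForm, quadForm, comp_apply, comp_apply, ← adjoint_inner_left]

/-- The Kraus operators of `tr_K ∘ Ad_U ∘ i_ω` are the slices of `U` along the basis vectors. -/
theorem isKrausFamily_partialTrace_Ad (U : HTensor H K →L[ℂ] HTensor H K) (e : K) :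
    IsKrausFamily (fun j => adjoint (slot H (c j)) ∘L U ∘L slot H e)
      (partialTrace c ∘ₗ Ad U ∘ₗ tensorRight (ketBra e e)) := by
  intro A hA y
  have hco : (Ad U (tensorRight (ketBra e e) A) : HTensor H K →L[ℂ] HTensor H K) =
      (U ∘L slot H e) ∘L (A : H →L[ℂ] H) ∘L adjoint (U ∘L slot H e) := by
    change U ∘L (tensorRight (ketBra e e) A : HTensor H K →L[ℂ] HTensor H K) ∘L adjoint U = _
    rw [coe_tensorRight_ketBra, adjoint_comp]
    rfl
  have hp : (Ad U (tensorRight (ketBra e e) A) : HTensor H K →L[ℂ] HTensor H K).IsPositive := by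
    rw [hco]
    exact hA.conj_adjoint _
  rw [LinearMap.comp_apply, LinearMap.comp_apply, isKrausFamily_partialTrace c _ hp]
  refine tsum_congr fun j => ?_
  rw [hco, quadForm_conj]
  simp only [adjoint_comp, comp_apply, adjoint_adjoint]

/-- A channel with a Kraus family indexed by the naturals has a unitary `V` on `H ⊗ K` whose powers
compress to the powers of the channel. -/
theorem exists_unitary_dilating {T : traceClass H →ₗ[ℂ] traceClass H}
    (hT : IsSchrodingerChannel T) {M : ℕ → H →L[ℂ] H} (hM : IsKrausFamily M T) :
    ∃ V : unitary (HTensor H K →L[ℂ] HTensor H K), ∀ n : ℕ,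
      T ^ n = partialTrace c ∘ₗ Ad ((V : HTensor H K →L[ℂ] HTensor H K) ^ n) ∘ₗ
        tensorRight (ketBra (c 0) (c 0)) := by
  obtain ⟨W, hW, hW0, hW1⟩ := exists_isometry_step c M fun x => hM.tsum_enorm hT x
  obtain ⟨S₀, h₀, hs₀, hc₀⟩ := exists_isometry_spread (H := H) c (r := 0) (by norm_num)
  obtain ⟨S₁, h₁, hs₁, hc₁⟩ := exists_isometry_spread (H := H) c (r := 1) (by norm_num)
  obtain ⟨V, hV⟩ := exists_unitary_mul_eq (A := HTensor H K →L[ℂ] HTensor H K) (w := W) (s₀ := S₀)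
    (s₁ := S₁) hW h₀ h₁
    (ContinuousLinearMap.ext fun z => eq_of_adjoint_slot_eq c fun u => by
      change adjoint (slot H (c u)) (adjoint S₀ (S₁ z)) = adjoint (slot H (c u)) 0
      rw [adjoint_slot_adjoint_spread c hs₀, hc₁, if_neg (by omega), map_zero])
    (ContinuousLinearMap.ext fun z => eq_of_adjoint_slot_eq c fun j => by
      change adjoint (slot H (c j)) (S₀ (adjoint S₀ z) + S₁ (adjoint S₁ z)) =
        adjoint (slot H (c j)) z
      rw [map_add, hc₀, hc₁, adjoint_slot_adjoint_spread c hs₀, adjoint_slot_adjoint_spread c hs₁]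
      rcases Nat.mod_two_eq_zero_or_one j with h | h
      · rw [if_pos h, if_neg (by omega), add_zero, show 2 * (j / 2) + 0 = j by omega]
      · rw [if_pos h, if_neg (by omega), zero_add, show 2 * (j / 2) + 1 = j by omega])
  refine ⟨V, ?_⟩
  set v := (V : HTensor H K →L[ℂ] HTensor H K)
  let Φ : ℕ → traceClass H →ₗ[ℂ] traceClass H := fun n =>
    partialTrace c ∘ₗ Ad (v ^ n) ∘ₗ tensorRight (ketBra (c 0) (c 0))
  -- `V` preserves the range of `S₀`, which contains the initial vectors `x ⊗ c_0`.
  have hpow : ∀ n x, (v ^ n) (slot H (c 0) x) = S₀ ((W ^ n) (slot H (c 0) x)) := fun n x => by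
    have h1 : v ^ n * S₀ = S₀ * W ^ n := by
      have h2 : SemiconjBy S₀ W v := hV.symm
      exact (h2.pow_right n).symm
    have h3 := DFunLike.congr_fun h1 (slot H (c 0) x)
    rw [mul_apply_eq_comp, mul_apply_eq_comp, hs₀] at h3
    exact h3
  let R : ℕ → ℕ → H →L[ℂ] H := fun n u => adjoint (slot H (c u)) ∘L (W ^ n) ∘L slot H (c 0)
  -- `Vⁿ (x ⊗ c_0)` lies in the range of `S₀`, so that only the slices along the `c_{2u}` survive.
  have hΦ : ∀ n, IsKrausFamily (R n) (Φ n) := by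
    intro n A hA y
    rw [isKrausFamily_partialTrace_Ad c (v ^ n) (c 0) A hA y]
    have hinj : Function.Injective fun u : ℕ => 2 * u := fun u w h => by
      simp only at h
      omega
    have hN : ∀ j, adjoint (slot H (c j)) ∘L (v ^ n) ∘L slot H (c 0) =
        if j % 2 = 0 then R n (j / 2) else 0 := fun j => by
      refine ContinuousLinearMap.ext fun x => ?_
      rw [comp_apply, comp_apply, hpow, hc₀]
      split_ifs <;> rfl
    simp_rw [hN]
    rw [← hinj.tsum_eq]
    · refine tsum_congr fun u => ?_
      simp
    · intro j hj
      by_cases h : j % 2 = 0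
      · exact ⟨j / 2, by simp only; omega⟩
      · simp [h, quadForm] at hj
  have hpos : ∀ n (A : traceClass H), (A : H →L[ℂ] H).IsPositive →
      (Φ n A : H →L[ℂ] H).IsPositive := by
    intro n A hA
    refine (isCompletelyPositive_partialTrace c).isPositive ?_
    exact ((isCompletelyPositive_tensorRight_ketBra (c 0)).isPositive hA).conj_adjoint _
  have hsucc : ∀ n, Φ (n + 1) = T ∘ₗ Φ n := by
    intro n
    refine ext_of_isPositive fun A hA => Subtype.ext ?_
    refine IsPositive.ext_quadForm (hpos _ A hA) (hT.1.isPositive (hpos n A hA)) fun y => ?_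
    -- The Kraus operators of step `n + 1` are the `M_k (R n u)`, at the index `⟨k, u⟩ + 1`.
    have hR0 : R (n + 1) 0 = 0 := ContinuousLinearMap.ext fun x => by
      change adjoint (slot H (c 0)) ((W ^ (n + 1)) (slot H (c 0) x)) = 0
      rw [pow_succ', mul_apply_eq_comp, hW0]
    have hR1 : ∀ k u, R (n + 1) (Nat.pair k u + 1) = M k ∘L R n u := fun k u =>
      ContinuousLinearMap.ext fun x => by
        change adjoint (slot H (c (Nat.pair k u + 1))) ((W ^ (n + 1)) (slot H (c 0) x)) =
          M k (adjoint (slot H (c u)) ((W ^ n) (slot H (c 0) x)))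
        rw [pow_succ', mul_apply_eq_comp, hW1]
    rw [hΦ _ A hA, tsum_eq_tsum_pair (by simp [hR0, quadForm]), LinearMap.comp_apply,
      hM _ (hpos n A hA)]
    refine tsum_congr fun k => ?_
    rw [hΦ n A hA]
    refine tsum_congr fun u => ?_
    rw [hR1, adjoint_comp, comp_apply]
  intro n
  change T ^ n = Φ n
  induction n with
  | zero =>
    refine LinearMap.ext fun A => ?_
    have h : Ad (v ^ 0) (tensorRight (ketBra (c 0) (c 0)) A) =
        tensorRight (ketBra (c 0) (c 0)) A := Subtype.ext (by
      change (v ^ 0) ∘L _ ∘L adjoint (v ^ 0) = _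
      rw [pow_zero, ContinuousLinearMap.adjoint_one]
      rfl)
    change A = partialTrace c (Ad (v ^ 0) (tensorRight (ketBra (c 0) (c 0)) A))
    rw [h, partialTrace_tensorRight]
  | succ n ih =>
    rw [pow_succ', ih, hsucc]
    rfl

/-- Unitaries whose powers compress to the powers of `T` form, with the pure ancilla `c_0` and the
partial trace, a unitary dilation of `T`. -/
theorem isUnitaryDilation_partialTrace [Nontrivial H] {T : traceClass H →ₗ[ℂ] traceClass H}
    {V : unitary (HTensor H K →L[ℂ] HTensor H K)}
    (hV : ∀ n : ℕ, T ^ n = partialTrace c ∘ₗ Ad ((V : HTensor H K →L[ℂ] HTensor H K) ^ n) ∘ₗ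
      tensorRight (ketBra (c 0) (c 0))) :
    IsUnitaryDilation T (fun n : ℤ => V ^ n) (tensorRight (ketBra (c 0) (c 0)))
      (partialTrace c) where
  map_zero := zpow_zero V
  map_add := zpow_add V
  cp_J := isCompletelyPositive_tensorRight_ketBra (c 0)
  norm_J := isLeast_norm_tensorRight c 0
  cp_E := isCompletelyPositive_partialTrace c
  dual_E := ⟨ampliation H K, isPartialTrace_partialTrace c,
    (isPartialTrace_partialTrace c).map_leftMul⟩
  left_inv := LinearMap.ext fun A => partialTrace_tensorRight c 0 A
  dilates n := by
    rw [hV n, zpow_natCast, SubmonoidClass.coe_pow]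

end Dilation

theorem separableSpace_of_hilbertBasis {H ι : Type*} [NormedAddCommGroup H]
    [InnerProductSpace ℂ H] [Countable ι] (b : HilbertBasis ι ℂ H) :
    TopologicalSpace.SeparableSpace H := by
  have h := (Set.countable_range b).isSeparable.span (R := ℂ) |>.closure
  rw [← Submodule.topologicalClosure_coe, b.dense_span] at h
  exact TopologicalSpace.isSeparable_univ_iff.1 h

end QuantumDilation

end

theorem theorem3p1 {H : Type*} [NormedAddCommGroup H] [InnerProductSpace ℂ H] [CompleteSpace H]
    [TopologicalSpace.SeparableSpace H] [Nontrivial H]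
    (T : QuantumDilation.traceClass H →ₗ[ℂ] QuantumDilation.traceClass H)
    (hT : QuantumDilation.IsSchrodingerChannel T) :
    ∃ (K : Type) (_ : NormedAddCommGroup K) (_ : InnerProductSpace ℂ K) (_ : CompleteSpace K)
      (_ : TopologicalSpace.SeparableSpace K)
      (ω : QuantumDilation.traceClass K)
      (V : unitary (QuantumDilation.HTensor H K →L[ℂ] QuantumDilation.HTensor H K))
      (trK : QuantumDilation.traceClass (QuantumDilation.HTensor H K) →ₗ[ℂ]
        QuantumDilation.traceClass H),
      QuantumDilation.IsPureState ω ∧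
      QuantumDilation.IsPartialTrace trK ∧
      QuantumDilation.IsUnitaryDilation T (fun n : ℤ => V ^ n)
        (QuantumDilation.tensorRight ω) trK ∧
      ∀ (n : ℕ) (A : QuantumDilation.traceClass H),
        (T ^ n) A = trK (QuantumDilation.Ad
          ((V : QuantumDilation.HTensor H K →L[ℂ] QuantumDilation.HTensor H K) ^ n)
          (QuantumDilation.tensorRight ω A)) := by
  obtain ⟨M, hM⟩ := hT.exists_isKrausFamily
  let c : HilbertBasis ℕ ℂ (lp (fun _ : ℕ => ℂ) 2) := ⟨LinearIsometryEquiv.refl ℂ _⟩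
  have hc : ‖c 0‖ = 1 := c.orthonormal.1 0
  obtain ⟨V, hV⟩ := QuantumDilation.exists_unitary_dilating c hT hM
  exact ⟨lp (fun _ : ℕ => ℂ) 2, inferInstance, inferInstance, inferInstance,
    QuantumDilation.separableSpace_of_hilbertBasis c, QuantumDilation.ketBra (c 0) (c 0), V,
    QuantumDilation.partialTrace c, QuantumDilation.isPureState_ketBra hc,
    QuantumDilation.isPartialTrace_partialTrace c,
    QuantumDilation.isUnitaryDilation_partialTrace c hV,
    fun n A => LinearMap.congr_fun (hV n) A⟩
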